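/- **Definitions.** Let $\lambda$ be a Dyck path from $(0,0)$ to $(2n,0)$, $n\ge 0$, with up steps $U=(1,1)$ and down steps $D=(1,-1)$, and write $\lambda(x)$ for its height at $x$. *Trees and labels.* $\mathrm{Tree}(\lambda)$ is the planted plane tree whose $n$ edges are the matched pairs $(U,D)$ of steps of $\lambda$ (the part of $\lambda$ strictly between the two steps is a Dyck word). The edge $e'$ lies between $e$ and the root, written $e\uparrow e'$, if the pair $e$ is nested strictly inside the pair $e'$. The edge $e'$ is strictly to the right of $e$, written $e\to e'$ (and $e$ is strictly to the left of $e'$), if the up step of $e'$ comes after the down step of $e$. A natural label $T_1$ is a bijection from the edges to $\{1,\dots,n\}$ with $T_1(e')<T_1(e)$ whenever $e\uparrow e'$. Its weakly increasing tree is $T_2(e):=\#\{e' : e\to e',\ T_1(e')<T_1(e)\}$. *Dyck tilings.* A box is a square with vertices $(x\pm1,y),(x,y\pm1)$, where $x+y$ is odd; $(x,y)$ is its centre. A Dyck tile is a set of boxes whose centres, read from left to right, form a translate of a Dyck path of some length $2r$, $r\ge0$ (a single box if $r=0$, non-trivial if $r\geq 1$); its weight is $\mathrm{art}(t)=(\#\mathrm{boxes}+1)/2=r+1$.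 A tiling of a set of boxes above $\lambda$ by Dyck tiles is cover-inclusive if every tile translated by $(0,-2)$ lies below $\lambda$ or is contained in another tile. A cover-inclusive Dyck tiling over $\lambda$ consists of a Dyck path $\mu\ge\lambda$ of the same length and a cover-inclusive tiling by Dyck tiles of the boxes between $\lambda$ and $\mu$. *Trajectories.* The entry of a Dyck tile is the south-east edge of its rightmost box; its exit is the north-west edge of its leftmost box. A trajectory of a tiling is a maximal sequence of tiles in which the exit of each tile is the entry of the next one. It is associated with an up step of $\lambda$ if a vertical translate of the entry of its first tile is that up step. *The sequence $\mathbf b$.* Let $R$ be the set of boxes whose centres $(x,y)$ satisfy $x\ge0$, $y\ge\lambda(x)+1$ and $x+y\le 2n-1$. Let $D_R$ be the cover-inclusive Dyck tiling of $R$ such that, for every edge $e$, exactly $T_2(e)$ non-trivial tiles lie over the pair of steps $e$, i.e. have boxes in all columns from the start of the up step of $e$ to the end of the down step of $e$. The anchor boxes are the boxes of $R$ with centres $(0,2n-1-2k)$, labelled $k=0,\dots,n-1$. Let $a_i$ be the label of the anchor box in which the trajectory of $D_R$ associated with the $i$-th up step of $\lambda$ from the right ends, and put $b_i:=a_i-\#\{a_j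 : j<i,\ a_j<a_i\}$. *The tiling $D_1$.* Let $D_1$ be the cover-inclusive Dyck tiling over $\lambda$ with Hermite history $\mathbf b=(b_1,\dots,b_n)$: for every $i$, the sum of $\mathrm{art}(t)$ over the tiles $t$ of the trajectory of $D_1$ associated with the $i$-th up step from the right is $b_i$, and $b_i=0$ if there is no such trajectory. *The tiling $DTS(T_1)$.* Let $e(i)$ be the edge with $T_1(e(i))=i$, and put $h_i:=2\,\#\{e' : e' \text{ strictly to the left of } e(i),\ T_1(e')<i\}+\#\{e' : e(i)\uparrow e'\}$. Starting from the empty tiling, perform the following two steps for $i=1,\dots,n$. Spread at $x=h_i$: cut the paths and the tiles along the line $x=h_i$, move the right part by $(2,0)$, and reconnect the lower path, the top path and every tile that was cut by $UD$. Strip-growth: attach a single box to the north-west of every up step of the top path to the right of the up step just inserted. The result is $DTS(T_1)$. **Theorem.** For every Dyck path $\lambda$ and every natural label $T_1$ of $\mathrm{Tree}(\lambda)$, the tiling $D_R$ exists and is unique, every up step of $\lambda$ has exactly one anchor label $a_i$, the tiling $D_1$ exists and is unique, and $$D_1=DTS(T_1),$$ that is, the two have the same lower path, the same top path and the same Dyck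 tiles. -/

import Mathlib

namespace DyckTiling

/-! ### Paths -/

/-- Height, after the first `x` steps, of the path with step sequence `w` that starts at height
`0`; after its last step the path stays at its final height. -/
def height (w : List DyckStep) (x : ℕ) : ℤ :=
  ((w.take x).count DyckStep.U : ℤ) - ((w.take x).count DyckStep.D : ℤ)

/-- The word `w` with an adjacent pair `UD` inserted after its first `m` letters. -/
def insertUD (w : List DyckStep) (m : ℕ) : List DyckStep :=
  w.take m ++ [DyckStep.U, DyckStep.D] ++ w.drop m

theorem count_insertUD (w : List DyckStep) (m : ℕ) (s : DyckStep) :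
    (insertUD w m).count s = w.count s + 1 := by
  have h : w.count s = (w.take m).count s + (w.drop m).count s := by
    rw [← List.count_append, List.take_append_drop]
  have h2 : [DyckStep.U, DyckStep.D].count s = 1 := by cases s <;> decide
  simp only [insertUD, List.count_append, h, h2]
  omega

/-- The Dyck path `w` with an adjacent pair `UD` inserted after its first `m` steps. -/
def insertPeak (w : DyckWord) (m : ℕ) : DyckWord where
  toList := insertUD w.toList m
  count_U_eq_count_D := by
    simp only [count_insertUD, w.count_U_eq_count_D]
  count_D_le_count_U i := by
    simp only [insertUD, List.take_append, List.count_append, List.take_take, List.take_drop]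
    set k := i - (w.toList.take m).length with hk
    have hmid : ([DyckStep.U, DyckStep.D].take k).count DyckStep.D
        ≤ ([DyckStep.U, DyckStep.D].take k).count DyckStep.U := by
      rcases k with _ | _ | k <;> simp
    by_cases hi : i ≤ (w.toList.take m).length
    · have h0 := w.count_D_le_count_U (min i m)
      have hk0 : k = 0 := by omega
      have hz : i - (w.toList.take m ++ [DyckStep.U, DyckStep.D]).length = 0 := by
        simp only [List.length_append]; omega
      rw [hz, hk0]
      simpa using h0
    · have hlen : (w.toList.take m).length ≤ m := by simp
      have hmin : w.toList.take (min i m) = w.toList.take m := by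
        by_cases h : m ≤ i
        · rw [min_eq_right h]
        · rw [min_eq_left (by omega), List.take_of_length_le, List.take_of_length_le]
          all_goals simp only [List.length_take] at hi ⊢; omega
      set r := i - (w.toList.take m ++ [DyckStep.U, DyckStep.D]).length
      have hsplit : ∀ s, (w.toList.take (m + r)).count s =
          (w.toList.take m).count s + ((w.toList.take (m + r)).drop m).count s := by
        intro s
        have h1 := List.take_append_drop m (w.toList.take (m + r))
        rw [List.take_take, min_eq_left (by omega)] at h1
        rw [← List.count_append, h1]
      have h0 := w.count_D_le_count_U (m + r)
      rw [hsplit, hsplit] at h0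
      rw [hmin]
      omega

/-! ### The planted plane tree of a Dyck path

The edges of `Tree(p)` are the matched pairs formed by an up step and a down step of `p`
(a pair `U w D` of consecutive letters of `p` in which `w` is a Dyck word). -/

/-- The `i`-th and the `j`-th step of `p` (counted from `0`) are an up step and a down step, and
the part of `p` strictly between them is a Dyck word. -/
def Matched (p : DyckWord) (i j : Fin p.toList.length) : Prop :=
  p.toList[i] = DyckStep.U ∧ p.toList[j] = DyckStep.D ∧ i < j ∧
    height p.toList j.val = height p.toList (i.val + 1) ∧
    ∀ k ∈ Finset.Icc (i.val + 1) j.val, height p.toList (i.val + 1) ≤ height p.toList k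

instance (p : DyckWord) (i j : Fin p.toList.length) : Decidable (Matched p i j) :=
  inferInstanceAs (Decidable (_ ∧ _))

/-- The edges of `Tree(p)`. -/
abbrev Edge (p : DyckWord) : Type :=
  {e : Fin p.toList.length × Fin p.toList.length // Matched p e.1 e.2}

/-- Index of the up step of an edge: this step runs from `x = up` to `x = up + 1`. -/
def Edge.up {p : DyckWord} (e : Edge p) : ℕ := e.1.1

/-- Index of the down step of an edge: this step runs from `x = down` to `x = down + 1`. -/
def Edge.down {p : DyckWord} (e : Edge p) : ℕ := e.1.2

/-- `e'` lies strictly between `e` and the root of the tree (`e ↑ e'`). -/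
def IsAbove {p : DyckWord} (e' e : Edge p) : Prop := e'.up < e.up ∧ e.down < e'.down

/-- `e'` is strictly to the right of `e` (`e → e'`), so that `e` is strictly to the left of `e'`. -/
def StrictlyRight {p : DyckWord} (e e' : Edge p) : Prop := e.down < e'.up

instance {p : DyckWord} (e' e : Edge p) : Decidable (IsAbove e' e) :=
  inferInstanceAs (Decidable (_ ∧ _))

instance {p : DyckWord} (e e' : Edge p) : Decidable (StrictlyRight e e') :=
  inferInstanceAs (Decidable (_ < _))

/-- A natural label of `Tree(p)`: an order-preserving bijection from the edges onto the labels.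
With `n` edges, the label `i ∈ {1, …, n}` is represented by `i - 1 : Fin n`. -/
structure NaturalLabel (p : DyckWord) where
  label : Edge p ≃ Fin p.semilength
  increasing : ∀ e' e : Edge p, IsAbove e' e → label e' < label e

/-- The weakly increasing tree `T₂` of a natural label `T₁`:
`T₂(e) = #{e' | T₁(e) > T₁(e'), e → e'}`. -/
def weakLabel {p : DyckWord} (T₁ : NaturalLabel p) (e : Edge p) : ℕ :=
  (Finset.univ.filter fun e' : Edge p => T₁.label e' < T₁.label e ∧ StrictlyRight e e').card

/-- The insertion history of a natural label:
`h_i = 2 #{e' | e' strictly left of e(i), n(e') < i} + #{e' | e(i) ↑ e'}`. -/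
def insertionHistory {p : DyckWord} (T₁ : NaturalLabel p) (i : Fin p.semilength) : ℕ :=
  2 * (Finset.univ.filter fun e' : Edge p =>
      StrictlyRight e' (T₁.label.symm i) ∧ T₁.label e' < i).card +
    (Finset.univ.filter fun e' : Edge p => IsAbove e' (T₁.label.symm i)).card

/-! ### Boxes and Dyck tiles -/

/-- A box, given by its centre `(x, y)`. It is the square with vertices `(x ± 1, y)` and
`(x, y ± 1)`; boxes of the lattice have `x + y` odd. -/
abbrev Box : Type := ℕ × ℤ

/-- A Dyck tile: `(x, y)` is the centre of its leftmost box, and the centres of its boxes, read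
from left to right, form a translate of the Dyck path `shape`. -/
@[ext]
structure Tile where
  x : ℕ
  y : ℤ
  shape : DyckWord
  deriving DecidableEq

/-- The number of steps from the leftmost box to the rightmost box. -/
def Tile.width (t : Tile) : ℕ := t.shape.toList.length

def Tile.boxes (t : Tile) : Finset Box :=
  (Finset.range (t.width + 1)).image fun i => (t.x + i, t.y + height t.shape.toList i)

/-- `art = (area + tiles) / 2` of a single tile (whose area is odd). -/
def Tile.art (t : Tile) : ℕ := (t.boxes.card + 1) / 2

/-- The tiles in `D` are contained in the region `S`, and cover every box of `S` exactly once. -/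
def Tiles (D : Finset Tile) (S : Set Box) : Prop :=
  (∀ t ∈ D, ∀ b ∈ t.boxes, b ∈ S) ∧ ∀ b ∈ S, ∃! t : Tile, t ∈ D ∧ b ∈ t.boxes

/-- Cover-inclusiveness, for tiles above the path `p`: every tile of `D` translated by `(0, -2)`
is below `p` or contained in a tile of `D`. -/
def CoverInclusive (p : DyckWord) (D : Finset Tile) : Prop :=
  ∀ t ∈ D, (∀ b ∈ t.boxes, b.2 - 2 + 1 ≤ height p.toList b.1) ∨
    ∃ t' ∈ D, ∀ b ∈ t.boxes, (b.1, b.2 - 2) ∈ t'.boxes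

/-! ### Trajectories -/

/-- The exit of `t` (north-west edge of its leftmost box) is the entry of `t'` (south-east edge of
its rightmost box). -/
def Attached (t t' : Tile) : Prop := t'.x + t'.width + 1 = t.x ∧ t'.y = t.y + 1

/-- `l` is a (full) trajectory of `D`: the list of the tiles that it passes through, from right to
left, with first tile `s` and last tile `f`. -/
structure IsTrajectory (D : Finset Tile) (l : List Tile) (s f : Tile) : Prop where
  mem : ∀ t ∈ l, t ∈ D
  head : l.head? = some s
  last : l.getLast? = some f
  chain : l.IsChain Attached
  maximal_right : ∀ t ∈ D, ¬ Attached t s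
  maximal_left : ∀ t ∈ D, ¬ Attached f t

/-- A trajectory with first tile `s` is associated with the up step of `e`: a vertical translate
of the entry of `s` is that up step. -/
def AssociatedWith {p : DyckWord} (s : Tile) (e : Edge p) : Prop := s.x + s.width = e.up

/-! ### The tiling of the region `R` and the sequence `b` -/

/-- The region `R` for a Dyck path `p` of length `2n`: all boxes with centre in `x ≥ 0` that are
above `p` and below the line from `(0, 2n)` to `(2n, 0)`. The boxes centred on `x = 0` belong to
it. -/
def regionR (p : DyckWord) : Set Box :=
  {b | Odd ((b.1 : ℤ) + b.2) ∧ height p.toList b.1 + 1 ≤ b.2 ∧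
    (b.1 : ℤ) + b.2 + 1 ≤ 2 * p.semilength}

/-- `t` is a non-trivial Dyck tile over the pair of steps `e`: it is not a single box, and it
runs over the whole part of the path from the up step to the down step of `e`. -/
def NontrivialOver {p : DyckWord} (t : Tile) (e : Edge p) : Prop :=
  0 < t.width ∧ t.x ≤ e.up ∧ e.down + 1 ≤ t.x + t.width

instance {p : DyckWord} (t : Tile) (e : Edge p) : Decidable (NontrivialOver t e) :=
  inferInstanceAs (Decidable (_ ∧ _))

/-- `D` is the cover-inclusive Dyck tiling in the region `R` that corresponds to the labels `T₂`:
it has exactly `T₂ e` non-trivial Dyck tiles over the pair of steps `e`, for every edge `e`. -/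
structure IsRegionTiling (p : DyckWord) (T₂ : Edge p → ℕ) (D : Finset Tile) : Prop where
  tiles : Tiles D (regionR p)
  coverInclusive : CoverInclusive p D
  count : ∀ e : Edge p, (D.filter fun t => NontrivialOver t e).card = T₂ e

/-- For every edge `e`, there is a trajectory of `D` associated with the up step of `e` that ends
at the anchor box with label `a e`. The anchor boxes are the boxes of `R` centred on `x = 0`,
labelled `0, …, n - 1` from top to bottom, so that the label `k` belongs to the box centred at
`(0, 2n - 1 - 2k)`. -/
def IsAnchorSequence (p : DyckWord) (D : Finset Tile) (a : Edge p → Fin p.semilength) : Prop :=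
  ∀ e : Edge p, ∃ l s f, IsTrajectory D l s f ∧ AssociatedWith s e ∧
    f.x = 0 ∧ f.y = 2 * (p.semilength : ℤ) - 1 - 2 * ((a e : ℕ) : ℤ)

/-- `b_i = a_i - #{a_j : j < i, a_j < a_i}`, where the up steps are numbered from right to left:
`j < i` means that the `j`-th up step is to the right of the `i`-th one. (The subtracted
number is at most `a_i`.) -/
def bSequence {p : DyckWord} (a : Edge p → Fin p.semilength) (e : Edge p) : ℕ :=
  (a e : ℕ) - ((Finset.univ.filter fun e' : Edge p => e.up < e'.up ∧ a e' < a e).image a).card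

/-! ### Dyck tilings over a Dyck path -/

/-- A diagram: a lower path, an upper path and a set of tiles. -/
@[ext]
structure Diagram where
  lower : List DyckStep
  upper : List DyckStep
  tiles : Finset Tile

/-- The boxes of the skew shape between the lower path `p` and the upper path `q`. -/
def skewShape (p q : DyckWord) : Set Box :=
  {b | Odd ((b.1 : ℤ) + b.2) ∧ height p.toList b.1 + 1 ≤ b.2 ∧ b.2 + 1 ≤ height q.toList b.1}

/-- `D` is a cover-inclusive Dyck tiling over `p`. -/
structure IsCoverInclusiveDyckTiling (p : DyckWord) (D : Diagram) : Prop where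
  lower_eq : D.lower = p.toList
  tiles : ∃ q : DyckWord, D.upper = q.toList ∧ q.toList.length = p.toList.length ∧
    (∀ x, height p.toList x ≤ height q.toList x) ∧ Tiles D.tiles (skewShape p q)
  coverInclusive : CoverInclusive p D.tiles

/-- `H` is the Hermite history of `D` with trajectories starting from the up steps: `H e` is the
total `art` of the tiles on the trajectory associated with the up step of `e`, and `0` if there is
no such trajectory. -/
def IsHermiteHistory {p : DyckWord} (D : Diagram) (H : Edge p → ℕ) : Prop :=
  ∀ e : Edge p,
    (∀ l s f, IsTrajectory D.tiles l s f → AssociatedWith s e → H e = (l.map Tile.art).sum) ∧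
    ((¬ ∃ l s f, IsTrajectory D.tiles l s f ∧ AssociatedWith s e) → H e = 0)

/-- `D` is a Dyck tiling constructed from the sequence `b` by the Hermite history: the
cover-inclusive Dyck tiling over `p` whose Hermite history is `b`. -/
def IsConstructedFrom (p : DyckWord) (b : Edge p → ℕ) (D : Diagram) : Prop :=
  IsCoverInclusiveDyckTiling p D ∧ IsHermiteHistory D b

/-! ### The Dyck tiling strip bijection -/

/-- The spread of a tile at `x = m`: it stays if it is to the left of the line, it moves by
`(2, 0)` if it is to the right, and if it is cut by the line (which then goes through the centre of
one of its boxes) the two pieces are reconnected by `UD`. -/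
def Tile.spread (m : ℕ) (t : Tile) : Tile :=
  if t.x + t.width < m then t
  else if m < t.x then ⟨t.x + 2, t.y, t.shape⟩
  else ⟨t.x, t.y, insertPeak t.shape (m - t.x)⟩

/-- The spread `sp_m` of a diagram at `x = m`. -/
def spread (m : ℕ) (D : Diagram) : Diagram where
  lower := insertUD D.lower m
  upper := insertUD D.upper m
  tiles := D.tiles.image (Tile.spread m)

/-- The strip-growth of a diagram that has just been spread at `x = m`. The steps of the upper path
with indices `m` and `m + 1` are the inserted pair `UD`. A single box is attached to the north-west
of every up step of the upper path to the right of that inserted up step. This moves the part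
of the upper path to the right of the pair `UD` by `(-1, 1)`: the inserted `D` is deleted, and a
`D` is appended at the end. -/
def stripGrowth (m : ℕ) (D : Diagram) : Diagram where
  lower := D.lower
  upper := D.upper.eraseIdx (m + 1) ++ [DyckStep.D]
  tiles := D.tiles ∪
    ((Finset.range D.upper.length).filter fun i => m < i ∧ D.upper[i]? = some DyckStep.U).image
      fun i => ⟨i, height D.upper i + 1, 0⟩

/-- The tiling `DTS(T₁)`: starting from the empty diagram, spread at `x = h_i` and then perform the
strip-growth, for `i = 1, …, n`, where `h` is the insertion history of `T₁`. (The insertion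
history of the tree without the edge of label `n` is `(h_1, …, h_{n-1})`.) -/
def DTS {p : DyckWord} (T₁ : NaturalLabel p) : Diagram :=
  (List.ofFn (insertionHistory T₁)).foldl (fun D m => stripGrowth m (spread m D)) ⟨[], [], ∅⟩

end DyckTiling

namespace DyckTiling
open DyckStep

/-! ### Heights -/

/-! A cover-inclusive tiling is rigid. Number the boxes above the lower path in each column by their
level, from the bottom. Translating a tile down by two shows, by induction, that all its boxes have
the same level (`level_eq_of_coverInclusive`), and that a step crossed by a tile on level `k + 1` is
also crossed on level `k`. So the tiling is determined by the number `M x` of boxes in each column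
and the number `C j` of levels on which the step `j` is crossed, and the conditions `IsCode` are the
ones that make such numbers come from a tiling: they force every maximal run of crossed steps to be
a Dyck path (`IsCode.height_run`, `exists_isCodedBy_of_coverInclusive`, `IsCodedBy.tiles`,
`IsCodedBy.coverInclusive`). Existence and uniqueness of tilings thus become statements about codes.

Trajectories are also visible in the code. Read from right to left, a trajectory keeps its level on
a crossed step and on an uncrossed down step, and gains one level on an uncrossed up step; the one
associated with `e` starts on level `C e.up` (`maximal_right_iff`). The Hermite history becomes the
recursion `remaining` (`isHermiteHistory_iff`).

In the region `R`, `C` is given by `T₂`, and `M x` counts the up steps from column `x` on. The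
trajectory of `e` has, in column `x`, the level `rank`: the number of edges with up step from `x` on
and label smaller than that of `e`. This invariant rests on `rank_lt_weakLabel_iff`: on its level
the trajectory finds the up step of `g` crossed exactly when `e` has a smaller label than `g`. In
column `0` the rank is the label of `e` counted from `0`, so the anchor labels are the reversed
labels, and `b` counts, for each edge, the larger labels with up step to its left (`bSequence_rev`).

It remains to show that `DTS(T₁)` is the only tiling with this Hermite history (`DTS_spec`). The
edge with the largest label is a leaf, hence a peak of the path, and its insertion position is its
index there. Deleting it lowers the inversion number by one at every up step to its right and
changes no other; at the peak itself the number is zero. Spread followed by strip-growth changes the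
Hermite history of a code in the same way (`twiceHistory_raise_lift`, `twiceHistory_raise_peak`).
Conversely, every code with no trajectory at the peak and trajectories at all up steps to its right
arises from such a step (`exists_raise_eq`). Induction on the number of edges gives existence,
uniqueness and the identification together. -/

theorem height_zero (w : List DyckStep) : height w 0 = 0 := by simp [height]

theorem height_succ_of_U {w : List DyckStep} {x : ℕ} (h : w[x]? = some U) :
    height w (x + 1) = height w x + 1 := by
  simp [height, List.take_add_one, h]; omega

theorem height_succ_of_D {w : List DyckStep} {x : ℕ} (h : w[x]? = some D) :
    height w (x + 1) = height w x - 1 := by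
  simp [height, List.take_add_one, h]; omega

theorem height_succ_of_none {w : List DyckStep} {x : ℕ} (h : w[x]? = none) :
    height w (x + 1) = height w x := by
  simp [height, List.take_add_one, h]

theorem getElem?_cases (w : List DyckStep) (x : ℕ) :
    w[x]? = some U ∨ w[x]? = some D ∨ w[x]? = none := by
  rcases h : w[x]? with _ | s
  · simp
  · rcases s with _ | _ <;> simp

theorem getElem?_cases_of_lt {w : List DyckStep} {x : ℕ} (hx : x < w.length) :
    w[x]? = some U ∨ w[x]? = some D := by
  rcases getElem?_cases w x with h | h | h
  · exact .inl h
  · exact .inr h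
  · rw [List.getElem?_eq_none_iff] at h; omega

theorem lt_length_of_getElem? {w : List DyckStep} {x : ℕ} {s : DyckStep} (h : w[x]? = some s) :
    x < w.length := by
  by_contra hc
  rw [List.getElem?_eq_none (by omega)] at h
  cases h

theorem height_nonneg (p : DyckWord) (x : ℕ) : 0 ≤ height p.toList x := by
  have := p.count_D_le_count_U x
  simp only [height]; omega

theorem height_of_length_le (p : DyckWord) {x : ℕ} (hx : p.toList.length ≤ x) :
    height p.toList x = 0 := by
  have := p.count_U_eq_count_D
  simp [height, List.take_of_length_le hx, this]

/-- The number `k` counts the down steps so far. This turns the parity condition on box centres into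
integrality of levels. -/
theorem height_parity (w : List DyckStep) {x : ℕ} (hx : x ≤ w.length) :
    ∃ k : ℕ, (x : ℤ) = height w x + 2 * k := by
  induction x with
  | zero => exact ⟨0, by simp [height_zero]⟩
  | succ x ih =>
    obtain ⟨k, hk⟩ := ih (by omega)
    rcases getElem?_cases_of_lt (show x < w.length by omega) with h | h
    · exact ⟨k, by rw [height_succ_of_U h]; push_cast; omega⟩
    · exact ⟨k + 1, by rw [height_succ_of_D h]; push_cast; omega⟩

theorem height_take_drop (w : List DyckStep) (x : ℕ) {i n : ℕ} (h : i ≤ n) :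
    height ((w.drop x).take n) i = height w (x + i) - height w x := by
  simp only [height, List.take_take, min_eq_left h, List.take_add, List.count_append]
  push_cast; ring

/-- Steps are differences of consecutive heights. Shapes of tiles and upper paths are identified in
this way. -/
theorem eq_of_height_eq {l l' : List DyckStep} (hl : l.length = l'.length)
    (h : ∀ i ≤ l.length, height l i = height l' i) : l = l' := by
  apply List.ext_getElem? fun i => ?_
  by_cases hi : i < l.length
  · have h0 := h i hi.le
    have h1 := h (i + 1) hi
    rcases getElem?_cases_of_lt hi with a | a <;>
    rcases getElem?_cases_of_lt (hl ▸ hi) with b | b <;> rw [a, b]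
    · rw [height_succ_of_U a, height_succ_of_D b] at h1; omega
    · rw [height_succ_of_D a, height_succ_of_U b] at h1; omega
  · rw [List.getElem?_eq_none (by omega), List.getElem?_eq_none (by omega)]

theorem length_insertUD (w : List DyckStep) (m : ℕ) :
    (insertUD w m).length = w.length + 2 := by
  simp [insertUD]; omega

theorem getElem?_insertUD_of_lt (w : List DyckStep) {m j : ℕ} (hm : m ≤ w.length) (hj : j < m) :
    (insertUD w m)[j]? = w[j]? := by
  simp only [insertUD, List.append_assoc]
  rw [List.getElem?_append_left (by simp; omega), List.getElem?_take_of_lt hj]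

theorem getElem?_insertUD_self (w : List DyckStep) {m : ℕ} (hm : m ≤ w.length) :
    (insertUD w m)[m]? = some U := by
  simp only [insertUD, List.append_assoc]
  rw [List.getElem?_append_right (by simp)]
  simp [min_eq_left hm]

theorem getElem?_insertUD_succ (w : List DyckStep) {m : ℕ} (hm : m ≤ w.length) :
    (insertUD w m)[m + 1]? = some D := by
  simp only [insertUD, List.append_assoc]
  rw [List.getElem?_append_right (by simp)]
  simp [min_eq_left hm]

theorem getElem?_insertUD_add_two (w : List DyckStep) {m j : ℕ} (hm : m ≤ w.length) (hj : m ≤ j) :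
    (insertUD w m)[j + 2]? = w[j]? := by
  simp only [insertUD]
  rw [List.getElem?_append_right (by simp; omega)]
  simp only [List.getElem?_drop]
  congr 1
  simp; omega

theorem height_insertUD_of_le (w : List DyckStep) {m x : ℕ} (hm : m ≤ w.length) (hx : x ≤ m) :
    height (insertUD w m) x = height w x := by
  have : (insertUD w m).take x = w.take x := by
    simp only [insertUD, List.append_assoc]
    rw [List.take_append_of_le_length (by simp; omega), List.take_take, min_eq_left hx]
  simp [height, this]

theorem height_insertUD_succ (w : List DyckStep) {m : ℕ} (hm : m ≤ w.length) :
    height (insertUD w m) (m + 1) = height w m + 1 := by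
  rw [height_succ_of_U (getElem?_insertUD_self w hm), height_insertUD_of_le w hm le_rfl]

theorem height_insertUD_add_two (w : List DyckStep) {m x : ℕ} (hm : m ≤ w.length) (hx : m ≤ x) :
    height (insertUD w m) (x + 2) = height w x := by
  induction x, hx using Nat.le_induction with
  | base =>
    rw [height_succ_of_D (x := m + 1) (getElem?_insertUD_succ w hm), height_insertUD_succ w hm]
    ring
  | succ x hx ih =>
    have h := getElem?_insertUD_add_two w hm hx
    rcases getElem?_cases w x with a | a | a <;> rw [a] at h
    · rw [height_succ_of_U a, height_succ_of_U (x := x + 2) h, ih]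
    · rw [height_succ_of_D a, height_succ_of_D (x := x + 2) h, ih]
    · rw [height_succ_of_none a, height_succ_of_none (x := x + 2) h, ih]

/-! ### Edges -/

namespace Edge

variable {p : DyckWord}

theorem getElem?_up (e : Edge p) : p.toList[e.up]? = some U := by
  have := e.2.1
  exact List.getElem?_eq_some_iff.2 ⟨e.1.1.2, this⟩

theorem getElem?_down (e : Edge p) : p.toList[e.down]? = some D := by
  have := e.2.2.1
  exact List.getElem?_eq_some_iff.2 ⟨e.1.2.2, this⟩

theorem up_lt_down (e : Edge p) : e.up < e.down := e.2.2.2.1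

theorem down_lt_length (e : Edge p) : e.down < p.toList.length := e.1.2.2

theorem height_up_succ (e : Edge p) :
    height p.toList (e.up + 1) = height p.toList e.up + 1 :=
  height_succ_of_U e.getElem?_up

theorem height_down (e : Edge p) : height p.toList e.down = height p.toList e.up + 1 := by
  rw [← e.height_up_succ]; exact e.2.2.2.2.1

theorem height_down_succ (e : Edge p) :
    height p.toList (e.down + 1) = height p.toList e.up := by
  rw [height_succ_of_D e.getElem?_down, e.height_down]; ring

theorem height_ge (e : Edge p) {k : ℕ} (h1 : e.up < k) (h2 : k ≤ e.down) :
    height p.toList e.up + 1 ≤ height p.toList k := by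
  rw [← e.height_up_succ]; exact e.2.2.2.2.2 k (Finset.mem_Icc.2 ⟨h1, h2⟩)

theorem exists_of_matched {i j : ℕ} (hij : i < j) (hi : p.toList[i]? = some U)
    (hj : p.toList[j]? = some D) (h : height p.toList j = height p.toList (i + 1))
    (hk : ∀ k, i < k → k ≤ j → height p.toList (i + 1) ≤ height p.toList k) :
    ∃ e : Edge p, e.up = i ∧ e.down = j := by
  have li := lt_length_of_getElem? hi
  have lj := lt_length_of_getElem? hj
  rw [List.getElem?_eq_getElem li] at hi
  rw [List.getElem?_eq_getElem lj] at hj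
  exact ⟨⟨(⟨i, li⟩, ⟨j, lj⟩), Option.some.inj hi, Option.some.inj hj, hij, h,
    fun k hk' => hk k (Finset.mem_Icc.1 hk').1 (Finset.mem_Icc.1 hk').2⟩, rfl, rfl⟩

/-- The partner is the down step of the first return to the height before the up step. -/
theorem exists_up_eq {i : ℕ} (hi : p.toList[i]? = some U) : ∃ e : Edge p, e.up = i := by
  classical
  have li := lt_length_of_getElem? hi
  have hu := height_succ_of_U hi
  have hex : ∃ j, i < j ∧ height p.toList (j + 1) ≤ height p.toList i :=
    ⟨p.toList.length, li, by
      rw [height_of_length_le p (by omega)]; exact height_nonneg p i⟩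
  obtain ⟨hj1, hj2⟩ := Nat.find_spec hex
  have hmin := fun k (hk : k < Nat.find hex) => Nat.find_min hex hk
  generalize Nat.find hex = j at *
  have hge : ∀ k, i < k → k ≤ j → height p.toList i + 1 ≤ height p.toList k := by
    intro k h1 h2
    rcases Nat.lt_or_ge (i + 1) k with h | h
    · have := hmin (k - 1) (by omega)
      rw [Nat.sub_add_cancel (by omega)] at this
      by_contra hc
      exact this ⟨by omega, by omega⟩
    · obtain rfl : k = i + 1 := by omega
      exact hu.ge
  have hj := hge j hj1 le_rfl
  rcases getElem?_cases p.toList j with h | h | h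
  · rw [height_succ_of_U h] at hj2; omega
  · rw [height_succ_of_D h] at hj2
    obtain ⟨e, he, -⟩ := exists_of_matched hj1 hi h (by omega)
      (fun k h1 h2 => by rw [hu]; exact hge k h1 h2)
    exact ⟨e, he⟩
  · rw [height_succ_of_none h] at hj2; omega

/-- The partner starts at the last earlier point that is not above the end of the down step. -/
theorem exists_down_eq {j : ℕ} (hj : p.toList[j]? = some D) : ∃ e : Edge p, e.down = j := by
  classical
  have hd := height_succ_of_D hj
  set P : ℕ → Prop := fun i => height p.toList i ≤ height p.toList (j + 1) with hP
  have h0 : P 0 := by rw [hP]; simp only [height_zero]; exact height_nonneg p _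
  have hi := Nat.findGreatest_spec (Nat.zero_le j) h0
  have hle := Nat.findGreatest_le (P := P) j
  have hmax := fun k (h1 : Nat.findGreatest P j < k) (h2 : k ≤ j) =>
    Nat.findGreatest_is_greatest h1 h2
  generalize Nat.findGreatest P j = i at *
  simp only [hP, not_le] at hi hmax
  have hij : i < j := by
    rcases hle.lt_or_eq with h | h
    · exact h
    · subst h; omega
  have h1 := hmax (i + 1) (by omega) hij
  rcases getElem?_cases p.toList i with h | h | h
  · have h2 := height_succ_of_U h
    obtain ⟨e, -, he⟩ := exists_of_matched hij h hj (by omega)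
      (fun k h1 h2 => by have := hmax k h1 h2; omega)
    exact ⟨e, he⟩
  · rw [height_succ_of_D h] at h1; omega
  · rw [height_succ_of_none h] at h1; omega

theorem down_eq_of_up_eq {e e' : Edge p} (h : e.up = e'.up) : e.down ≤ e'.down := by
  by_contra hc
  have h1 := e.height_ge (k := e'.down + 1) (by have := e'.up_lt_down; omega) (by omega)
  rw [e'.height_down_succ, h] at h1
  omega

theorem up_injective : Function.Injective (Edge.up (p := p)) := fun _ _ h =>
  Subtype.ext (Prod.ext (Fin.ext h)
    (Fin.ext (le_antisymm (down_eq_of_up_eq h) (down_eq_of_up_eq h.symm))))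

theorem up_le_of_down_eq {e e' : Edge p} (h : e.down = e'.down) : e'.up ≤ e.up := by
  by_contra hc
  have h1 := e.height_ge (k := e'.up) (by omega) (by have := e'.up_lt_down; omega)
  have h2 := e.height_down
  have h3 := e'.height_down
  rw [h] at h2
  omega

theorem down_injective : Function.Injective (Edge.down (p := p)) := fun _ _ h =>
  up_injective (le_antisymm (up_le_of_down_eq h.symm) (up_le_of_down_eq h))

theorem up_ne_down (e e' : Edge p) : e.up ≠ e'.down := fun h => by
  have := e.getElem?_up
  rw [h, e'.getElem?_down] at this
  cases this

/-- Matched pairs do not cross: if `e` closed inside `e'`, the height after `e.down` would be both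
equal to that at `e.up` and at least two larger. -/
theorem strictlyRight_or_isAbove {e e' : Edge p} (h : e.up < e'.up) :
    StrictlyRight e e' ∨ IsAbove e e' := by
  by_contra hc
  simp only [StrictlyRight, IsAbove, not_or, not_and, not_lt] at hc
  obtain ⟨h1, h2⟩ := hc
  have h2 := h2 h
  have h3 : e'.up ≠ e.down := up_ne_down e' e
  have h4 : e.down ≠ e'.down := fun h' => by
    have := down_injective h'; subst this; omega
  have h5 := e'.height_ge (k := e.down + 1) (by omega) (by omega)
  have h6 := e.height_ge (k := e'.up) h (by omega)
  rw [e.height_down_succ] at h5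
  omega

theorem exists_of_lt {j : ℕ} (hj : j < p.toList.length) :
    (∃ e : Edge p, e.up = j) ∨ ∃ e : Edge p, e.down = j := by
  rcases getElem?_cases_of_lt hj with h | h
  · exact .inl (exists_up_eq h)
  · exact .inr (exists_down_eq h)

end Edge

/-! ### Codes of cover-inclusive Dyck tilings

The boxes above `p` in the column `x` are numbered by their level `0, 1, 2, …` from the bottom. In
a cover-inclusive tiling all boxes of a tile have the same level, and the tiles of level `k` are
the maximal runs of columns that are not separated on this level. Such a tiling is encoded by
the number `M x` of boxes in each column `x` and the number `C j` of levels on which a tile crosses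
the step `j`. -/

/-- The region with `M x` boxes in the column `x`. -/
def columnRegion (p : DyckWord) (M : ℕ → ℕ) : Set Box :=
  {b | ∃ k : ℕ, k < M b.1 ∧ b.2 = height p.toList b.1 + 1 + 2 * k}

/-- The column heights `M` vanish outside of `p` and decrease by at most one along every up step. -/
structure IsColumnHeight (p : DyckWord) (M : ℕ → ℕ) : Prop where
  le_of_up : ∀ x, p.toList[x]? = some U → M x ≤ M (x + 1) + 1
  eq_zero : ∀ x, p.toList.length ≤ x → M x = 0

/-- `C j` is the number of tiles that cross the step `j` in a cover-inclusive tiling of the region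
with `M x` boxes in the column `x`. -/
structure IsCode (p : DyckWord) (C M : ℕ → ℕ) : Prop where
  pair : ∀ e : Edge p, C e.up = C e.down
  nest : ∀ (e : Edge p) (j : ℕ), e.up ≤ j → j ≤ e.down → C e.up ≤ C j
  le : ∀ (e : Edge p) (x : ℕ), e.up ≤ x → x ≤ e.down + 1 → C e.up ≤ M x
  eq_zero : ∀ j, p.toList.length ≤ j → C j = 0

/-- `t` is the tile of level `k` with leftmost column `t.x` in the tiling encoded by `C` and `M`. -/
structure IsTileOf (p : DyckWord) (C M : ℕ → ℕ) (t : Tile) (k : ℕ) : Prop where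
  y_eq : t.y = height p.toList t.x + 1 + 2 * k
  lt : k < M t.x
  left : ∀ j, j + 1 = t.x → C j ≤ k
  run : ∀ j, t.x ≤ j → j < t.x + t.width → k < C j
  right : C (t.x + t.width) ≤ k
  shape_eq : t.shape.toList = (p.toList.drop t.x).take t.width

/-- `D` is the tiling encoded by `C` and `M`. -/
def IsCodedBy (D : Finset Tile) (p : DyckWord) (C M : ℕ → ℕ) : Prop :=
  ∀ t, t ∈ D ↔ ∃ k, IsTileOf p C M t k

theorem Tile.mem_boxes {t : Tile} {c : ℕ} {v : ℤ} :
    (c, v) ∈ t.boxes ↔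
      ∃ i ≤ t.width, c = t.x + i ∧ v = t.y + height t.shape.toList i := by
  simp only [Tile.boxes, Finset.mem_image, Finset.mem_range, Prod.mk.injEq, Nat.lt_succ_iff]
  constructor
  · rintro ⟨i, h1, h2, h3⟩; exact ⟨i, h1, h2.symm, h3.symm⟩
  · rintro ⟨i, h1, h2, h3⟩; exact ⟨i, h1, h2.symm, h3.symm⟩

theorem Tile.card_boxes (t : Tile) : t.boxes.card = t.width + 1 := by
  rw [Tile.boxes, Finset.card_image_of_injective, Finset.card_range]
  intro i j h
  simpa using (Prod.mk.inj h).1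

/-- The width is even because the shape is a Dyck path, so the division in `art` is exact. Each
crossed step contributes one and each tile two more, which is what `remaining` adds up. -/
theorem Tile.two_mul_art (t : Tile) : 2 * t.art = t.width + 2 := by
  have h : t.width = 2 * t.shape.semilength := t.shape.two_mul_semilength_eq_length.symm
  rw [Tile.art, Tile.card_boxes]; omega

theorem Tile.mem_boxes_iff_of_height {p : DyckWord} {t : Tile} {k : ℕ}
    (h : ∀ i ≤ t.width, t.y + height t.shape.toList i = height p.toList (t.x + i) + 1 + 2 * k)
    {c : ℕ} {v : ℤ} :
    (c, v) ∈ t.boxes ↔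
      t.x ≤ c ∧ c ≤ t.x + t.width ∧ v = height p.toList c + 1 + 2 * k := by
  rw [Tile.mem_boxes]
  constructor
  · rintro ⟨i, hi, rfl, rfl⟩
    exact ⟨by omega, by omega, h i hi⟩
  · rintro ⟨h1, h2, rfl⟩
    refine ⟨c - t.x, by omega, by omega, ?_⟩
    rw [h _ (by omega), Nat.add_sub_cancel' h1]

/-! ### Maximal runs of crossed steps -/

namespace IsCode

variable {p : DyckWord} {C M : ℕ → ℕ}

theorem le_left (h : IsCode p C M) (j : ℕ) : C j ≤ M j := by
  by_cases hj : j < p.toList.length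
  · rcases Edge.exists_of_lt hj with ⟨e, rfl⟩ | ⟨e, rfl⟩
    · exact h.le e _ le_rfl (by have := e.up_lt_down; omega)
    · rw [← h.pair]; exact h.le e _ e.up_lt_down.le (by omega)
  · rw [h.eq_zero j (by omega)]; exact Nat.zero_le _

theorem le_right (h : IsCode p C M) (j : ℕ) : C j ≤ M (j + 1) := by
  by_cases hj : j < p.toList.length
  · rcases Edge.exists_of_lt hj with ⟨e, rfl⟩ | ⟨e, rfl⟩
    · exact h.le e _ (by omega) (by have := e.up_lt_down; omega)
    · rw [← h.pair]; exact h.le e _ (by have := e.up_lt_down; omega) (by omega)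
  · rw [h.eq_zero j (by omega)]; exact Nat.zero_le _

/-- A maximal run of steps that are crossed on the level `k` forms a Dyck path. -/
theorem height_run (h : IsCode p C M) {k x X : ℕ} (hx : x ≤ X)
    (hl : ∀ j, j + 1 = x → C j ≤ k) (hrun : ∀ j, x ≤ j → j < X → k < C j) (hr : C X ≤ k) :
    (∀ j, x ≤ j → j ≤ X → height p.toList x ≤ height p.toList j) ∧
      height p.toList X = height p.toList x := by
  have hlen : ∀ j, x ≤ j → j < X → j < p.toList.length := by
    intro j h1 h2
    by_contra hc
    have := hrun j h1 h2
    rw [h.eq_zero j (by omega)] at this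
    omega
  have hmin : ∀ j, x ≤ j → j ≤ X → ∀ i, x ≤ i → i ≤ j →
      height p.toList x ≤ height p.toList i := by
    intro j h1
    induction j, h1 using Nat.le_induction with
    | base => intro _ i h2 h3; rw [le_antisymm h3 h2]
    | succ j h1 ih =>
      intro h2 i h3 h4
      have ih := ih (by omega)
      rcases Nat.lt_or_ge i (j + 1) with h5 | h5
      · exact ih i h3 (by omega)
      obtain rfl : i = j + 1 := by omega
      rcases Edge.exists_of_lt (hlen j h1 (by omega)) with ⟨e, rfl⟩ | ⟨e, rfl⟩
      · have := ih e.up h1 le_rfl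
        rw [e.height_up_succ]; omega
      · have hlt := e.up_lt_down
        rw [e.height_down_succ]
        -- A drop below the starting height needs a down step whose partner lies before the run.
        -- That edge encloses the uncrossed step `x - 1`, so `nest` prevents its own steps from
        -- being crossed on level `k`.
        by_contra hc
        have hup : e.up < x := by
          by_contra hxe
          exact hc (ih e.up (by omega) hlt.le)
        have h4 := h.nest e (x - 1) (by omega) (by omega)
        have h5 := hl (x - 1) (by omega)
        have h6 := hrun _ h1 (by omega)
        rw [← h.pair] at h6
        omega
  refine ⟨fun j h1 h2 => hmin j h1 h2 j h1 le_rfl, ?_⟩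
  have hge := hmin X hx le_rfl X hx le_rfl
  by_contra hne
  -- If the run ended higher, the step after its last visit to the starting height would be an up
  -- step matched at `X` or later. By `nest` the uncrossed step `X` would then make this up step
  -- uncrossed as well.
  set P : ℕ → Prop := fun i => height p.toList i ≤ height p.toList x with hP
  have hi : P (Nat.findGreatest P X) := Nat.findGreatest_spec hx (le_refl (height p.toList x))
  have hxi : x ≤ Nat.findGreatest P X := Nat.le_findGreatest hx (le_refl (height p.toList x))
  have hle := Nat.findGreatest_le (P := P) X
  have hmax := fun k (h1 : Nat.findGreatest P X < k) (h2 : k ≤ X) =>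
    Nat.findGreatest_is_greatest h1 h2
  generalize Nat.findGreatest P X = i at *
  simp only [hP, not_le] at hi hmax
  have hiX : i < X := by
    rcases hle.lt_or_eq with h | h
    · exact h
    · subst h; omega
  have h1 := hmax (i + 1) (by omega) hiX
  rcases Edge.exists_of_lt (hlen i hxi hiX) with ⟨e, rfl⟩ | ⟨e, rfl⟩
  · have h2 : X ≤ e.down := by
      by_contra hc
      have h3 := hmax (e.down + 1) (by have := e.up_lt_down; omega) (by omega)
      rw [e.height_down_succ] at h3
      omega
    have h3 := h.nest e X hiX.le h2
    have h4 := hrun e.up hxi hiX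
    omega
  · rw [e.height_down_succ] at h1
    have := e.height_down
    omega

end IsCode

namespace IsTileOf

variable {p : DyckWord} {C M : ℕ → ℕ} {t t' : Tile} {k : ℕ}

theorem height_shape (ht : IsTileOf p C M t k) {i : ℕ} (hi : i ≤ t.width) :
    t.y + height t.shape.toList i = height p.toList (t.x + i) + 1 + 2 * k := by
  rw [ht.shape_eq, height_take_drop _ _ hi, ht.y_eq]; ring

theorem mem_boxes_iff (ht : IsTileOf p C M t k) {c : ℕ} {v : ℤ} :
    (c, v) ∈ t.boxes ↔
      t.x ≤ c ∧ c ≤ t.x + t.width ∧ v = height p.toList c + 1 + 2 * k :=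
  Tile.mem_boxes_iff_of_height fun _ => ht.height_shape

theorem height_right (ht : IsTileOf p C M t k) (h : IsCode p C M) :
    height p.toList (t.x + t.width) = height p.toList t.x :=
  (h.height_run (by omega) ht.left ht.run ht.right).2

theorem lt_of_mem (ht : IsTileOf p C M t k) (h : IsCode p C M) {c : ℕ} (h1 : t.x ≤ c)
    (h2 : c ≤ t.x + t.width) : k < M c := by
  rcases h1.eq_or_lt with rfl | h3
  · exact ht.lt
  · have h4 := ht.run (c - 1) (by omega) (by omega)
    have h5 := h.le_right (c - 1)
    rw [Nat.sub_add_cancel (by omega)] at h5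
    omega

theorem x_le_of_overlap (ht : IsTileOf p C M t k) (ht' : IsTileOf p C M t' k) {c : ℕ}
    (h2 : c ≤ t.x + t.width) (h3 : t'.x ≤ c) : t'.x ≤ t.x := by
  by_contra hc
  have h5 := ht.run (t'.x - 1) (by omega) (by omega)
  have h6 := ht'.left (t'.x - 1) (by omega)
  omega

theorem right_le_of_overlap (ht : IsTileOf p C M t k) (ht' : IsTileOf p C M t' k) {c : ℕ}
    (h1 : t.x ≤ c) (h4 : c ≤ t'.x + t'.width) :
    t.x + t.width ≤ t'.x + t'.width := by
  by_contra hc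
  have h5 := ht.run (t'.x + t'.width) (by omega) (by omega)
  have h6 := ht'.right
  omega

/-- Both tiles are maximal runs on the same level; two such runs with a common column have the same
ends. -/
theorem eq_of_overlap (ht : IsTileOf p C M t k) (ht' : IsTileOf p C M t' k) {c : ℕ}
    (h1 : t.x ≤ c) (h2 : c ≤ t.x + t.width) (h3 : t'.x ≤ c) (h4 : c ≤ t'.x + t'.width) :
    t = t' := by
  have hx : t.x = t'.x :=
    le_antisymm (ht'.x_le_of_overlap ht h4 h1) (ht.x_le_of_overlap ht' h2 h3)
  have hw : t.width = t'.width := by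
    have := ht.right_le_of_overlap ht' h1 h4
    have := ht'.right_le_of_overlap ht h3 h2
    omega
  ext1
  · exact hx
  · rw [ht.y_eq, ht'.y_eq, hx]
  · apply DyckWord.ext
    rw [ht.shape_eq, ht'.shape_eq, hx, hw]

end IsTileOf

/-- Extend the column `c` in both directions as long as the steps are crossed on level `k`; by
`height_run` the run so obtained is the shape of a tile. -/
theorem IsCode.exists_isTileOf {p : DyckWord} {C M : ℕ → ℕ} (h : IsCode p C M) {c k : ℕ}
    (hk : k < M c) : ∃ t, IsTileOf p C M t k ∧ t.x ≤ c ∧ c ≤ t.x + t.width := by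
  have hl : ∃ x ≤ c, (∀ j, x ≤ j → j < c → k < C j) ∧ ∀ j, j + 1 = x → C j ≤ k := by
    clear hk
    induction c with
    | zero => exact ⟨0, le_rfl, fun j _ h => by omega, fun j h => by omega⟩
    | succ c ih =>
      by_cases hc : C c ≤ k
      · exact ⟨c + 1, le_rfl, fun j _ h => by omega, fun j h => by
          obtain rfl : j = c := by omega
          exact hc⟩
      · obtain ⟨x, h1, h2, h3⟩ := ih
        refine ⟨x, by omega, fun j h4 h5 => ?_, h3⟩
        rcases Nat.lt_or_ge j c with h6 | h6
        · exact h2 j h4 h6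
        · obtain rfl : j = c := by omega
          omega
  have hr : ∃ X, c ≤ X ∧ C X ≤ k :=
    ⟨max c p.toList.length, le_max_left _ _, by rw [h.eq_zero _ (le_max_right _ _)]; omega⟩
  classical
  obtain ⟨hX1, hX2⟩ := Nat.find_spec hr
  have hmin := fun j (hj : j < Nat.find hr) => Nat.find_min hr hj
  generalize Nat.find hr = X at *
  obtain ⟨x, hxc, hx1, hx2⟩ := hl
  have hrun : ∀ j, x ≤ j → j < X → k < C j := by
    intro j h1 h2
    rcases Nat.lt_or_ge j c with h3 | h3
    · exact hx1 j h1 h3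
    · by_contra hc
      exact hmin j h2 ⟨h3, by omega⟩
  obtain ⟨hge, hend⟩ := h.height_run (hxc.trans hX1) hx2 hrun hX2
  have hkx : k < M x := by
    rcases hxc.eq_or_lt with rfl | h3
    · exact hk
    · exact (hrun x le_rfl (by omega)).trans_le (h.le_left x)
  have hXlen : X ≤ p.toList.length ∨ x = X := by
    by_contra hc
    have := hrun (X - 1) (by omega) (by omega)
    rw [h.eq_zero _ (by omega)] at this
    omega
  have hlen : ((p.toList.drop x).take (X - x)).length = X - x := by
    simp only [List.length_take, List.length_drop]; omega
  have hsub : ∀ i ≤ X - x, 0 ≤ height ((p.toList.drop x).take (X - x)) i := fun i hi => by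
    rw [height_take_drop _ _ hi]
    have := hge (x + i) (by omega) (by omega)
    omega
  refine ⟨⟨x, height p.toList x + 1 + 2 * k, ⟨(p.toList.drop x).take (X - x), ?_, ?_⟩⟩,
    ⟨rfl, hkx, hx2, ?_, ?_, ?_⟩, hxc, ?_⟩
  · have h0 := height_take_drop p.toList x (le_refl (X - x))
    rw [show x + (X - x) = X by omega, hend, sub_self, height, List.take_take, min_self] at h0
    omega
  · intro i
    rcases le_total i (X - x) with hi | hi
    · have h0 := hsub i hi
      rw [height] at h0
      omega
    · have h0 := hsub _ le_rfl
      rw [height, List.take_take, min_self] at h0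
      rw [List.take_of_length_le (by omega)]
      omega
  all_goals simp only [Tile.width, hlen]
  · intro j h1 h2; exact hrun j h1 (by omega)
  · rw [show x + (X - x) = X by omega]; exact hX2
  · omega

theorem IsTileOf.level_unique {p : DyckWord} {C M : ℕ → ℕ} {t : Tile} {k k' : ℕ}
    (ht : IsTileOf p C M t k) (ht' : IsTileOf p C M t k') : k = k' := by
  have h1 := ht.y_eq
  have h2 := ht'.y_eq
  omega

/-- A tile of level `k` lies over the steps of `e` if and only if it crosses the up step of `e`. -/
theorem IsTileOf.nontrivialOver_iff {p : DyckWord} {C M : ℕ → ℕ} {t : Tile} {k : ℕ}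
    (ht : IsTileOf p C M t k) (h : IsCode p C M) (e : Edge p) :
    NontrivialOver t e ↔ t.x ≤ e.up ∧ e.up < t.x + t.width := by
  have hlt := e.up_lt_down
  refine ⟨fun ⟨_, h2, h3⟩ => ⟨h2, by omega⟩, fun ⟨h1, h2⟩ => ⟨by omega, h1, ?_⟩⟩
  by_contra hc
  have h3 := h.nest e (t.x + t.width) (by omega) (by omega)
  have h4 := ht.run _ h1 h2
  have h5 := ht.right
  omega

/-! ### From codes to cover-inclusive tilings -/

namespace IsCodedBy

variable {p : DyckWord} {C M : ℕ → ℕ} {D : Finset Tile}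

theorem exists_mem (hD : IsCodedBy D p C M) (h : IsCode p C M) {c k : ℕ} (hk : k < M c) :
    ∃ t ∈ D, IsTileOf p C M t k ∧ t.x ≤ c ∧ c ≤ t.x + t.width := by
  obtain ⟨t, ht, h1, h2⟩ := h.exists_isTileOf hk
  exact ⟨t, (hD t).2 ⟨k, ht⟩, ht, h1, h2⟩

theorem tiles (hD : IsCodedBy D p C M) (h : IsCode p C M) : Tiles D (columnRegion p M) := by
  constructor
  · rintro t ht ⟨c, v⟩ hb
    obtain ⟨k, hk⟩ := (hD t).1 ht
    obtain ⟨h1, h2, h3⟩ := hk.mem_boxes_iff.1 hb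
    exact ⟨k, hk.lt_of_mem h h1 h2, h3⟩
  · rintro ⟨c, v⟩ ⟨k, hk, hv⟩
    obtain ⟨t, ht, hk', h1, h2⟩ := hD.exists_mem h hk
    refine ⟨t, ⟨ht, hk'.mem_boxes_iff.2 ⟨h1, h2, hv⟩⟩, ?_⟩
    rintro s ⟨hs, hb⟩
    obtain ⟨k₂, hk₂⟩ := (hD s).1 hs
    obtain ⟨h3, h4, h5⟩ := hk₂.mem_boxes_iff.1 hb
    obtain rfl : k = k₂ := by simp only at hv; omega
    exact hk₂.eq_of_overlap hk' h3 h4 h1 h2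

/-- A step crossed on level `k + 1` is crossed on level `k`, so a run is contained in a run one
level below. -/
theorem coverInclusive (hD : IsCodedBy D p C M) (h : IsCode p C M) : CoverInclusive p D := by
  intro t ht
  obtain ⟨k, hk⟩ := (hD t).1 ht
  rcases k with _ | k
  · left
    rintro ⟨c, v⟩ hb
    obtain ⟨h1, h2, h3⟩ := hk.mem_boxes_iff.1 hb
    simp only [Nat.cast_zero] at h3 ⊢
    omega
  · right
    obtain ⟨s, hs, hks, h1, h2⟩ := hD.exists_mem h (show k < M t.x by have := hk.lt; omega)
    refine ⟨s, hs, ?_⟩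
    rintro ⟨c, v⟩ hb
    obtain ⟨h3, h4, h5⟩ := hk.mem_boxes_iff.1 hb
    have h6 : t.x + t.width ≤ s.x + s.width := by
      by_contra hc
      have h7 := hk.run (s.x + s.width) h2 (by omega)
      have h8 := hks.right
      omega
    refine hks.mem_boxes_iff.2 ⟨by omega, by omega, ?_⟩
    push_cast at h5
    change v - 2 = height p.toList c + 1 + 2 * (k : ℤ)
    omega

/-- Each level below `C e.up` has exactly one tile that crosses the up step of `e`, and by `nest`
this tile continues to the end of its down step. -/
theorem card_filter_nontrivialOver (hD : IsCodedBy D p C M) (h : IsCode p C M) (e : Edge p) :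
    (D.filter fun t => NontrivialOver t e).card = C e.up := by
  rw [← Finset.card_range (C e.up)]
  symm
  choose f hf using fun (k : ℕ) (hk : k < C e.up) =>
    hD.exists_mem h (hk.trans_le (h.le_left e.up))
  refine Finset.card_bij (fun k hk => f k (Finset.mem_range.1 hk)) ?_ ?_ ?_
  · intro k hk
    obtain ⟨h1, h2, h3, h4⟩ := hf k (Finset.mem_range.1 hk)
    refine Finset.mem_filter.2 ⟨h1, (h2.nontrivialOver_iff h e).2 ⟨h3, ?_⟩⟩
    refine h4.lt_of_ne fun h5 => ?_
    have h6 := h2.right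
    rw [← h5] at h6
    have := Finset.mem_range.1 hk
    omega
  · intro k hk k' hk' heq
    have h1 := (hf k (Finset.mem_range.1 hk)).2.1
    have h2 := (hf k' (Finset.mem_range.1 hk')).2.1
    rw [heq] at h1
    exact h1.level_unique h2
  · intro t ht
    obtain ⟨ht, hte⟩ := Finset.mem_filter.1 ht
    obtain ⟨k, hk⟩ := (hD t).1 ht
    obtain ⟨h1, h2⟩ := (hk.nontrivialOver_iff h e).1 hte
    have hkC := hk.run _ h1 h2
    obtain ⟨-, h3, h4, h5⟩ := hf k hkC
    exact ⟨k, Finset.mem_range.2 hkC, h3.eq_of_overlap hk h4 h5 h1 h2.le⟩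

end IsCodedBy

/-- Only finiteness is at stake: a tile is determined by its leftmost column and its level, and both
are bounded. -/
theorem exists_isCodedBy (p : DyckWord) (C : ℕ → ℕ) {M : ℕ → ℕ}
    (hM : ∀ x, p.toList.length ≤ x → M x = 0) : ∃ D, IsCodedBy D p C M := by
  have hfin : {t : Tile | ∃ k, IsTileOf p C M t k}.Finite := by
    have hsub : {t : Tile | ∃ k, IsTileOf p C M t k} ⊆
        ⋃ x ∈ Set.Iio p.toList.length, ⋃ k ∈ Set.Iio (M x),
          {t : Tile | IsTileOf p C M t k ∧ t.x = x} := by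
      rintro t ⟨k, hk⟩
      simp only [Set.mem_iUnion]
      refine ⟨t.x, ?_, k, hk.lt, hk, rfl⟩
      by_contra hc
      have h1 := hk.lt
      rw [hM _ (by simpa using hc)] at h1
      omega
    refine Set.Finite.subset ((Set.finite_Iio _).biUnion fun x _ =>
      (Set.finite_Iio _).biUnion fun k _ => Set.Subsingleton.finite ?_) hsub
    rintro t ⟨ht, rfl⟩ t' ⟨ht', hx⟩
    exact ht.eq_of_overlap ht' le_rfl (by omega) hx.le (by omega)
  exact ⟨hfin.toFinset, fun t => by simp⟩

/-- In a cover-inclusive tiling all boxes of a tile have the same level. -/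
theorem level_eq_of_coverInclusive {p : DyckWord} {M : ℕ → ℕ} {D : Finset Tile}
    (hT : Tiles D (columnRegion p M)) (hD : CoverInclusive p D) (k : ℕ) :
    ∀ t ∈ D, ∀ b ∈ t.boxes, b.2 = height p.toList b.1 + 1 + 2 * k →
      ∀ b' ∈ t.boxes, b'.2 = height p.toList b'.1 + 1 + 2 * k := by
  induction k with
  | zero =>
    intro t ht b hb hbk b' hb'
    rcases hD t ht with h | ⟨s, hs, h⟩
    · obtain ⟨k', -, hk'⟩ := hT.1 t ht b' hb'
      have := h b' hb'
      push_cast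
      omega
    -- A tile with a box on the bottom level cannot have its translate inside another tile: the
    -- translated box would lie outside the region.
    · obtain ⟨k', -, hk'⟩ := hT.1 s hs _ (h b hb)
      simp only at hk'
      omega
  | succ k ih =>
    intro t ht b hb hbk b' hb'
    push_cast at hbk ⊢
    rcases hD t ht with h | ⟨s, hs, h⟩
    · have := h b hb
      omega
    · have := ih s hs _ (h b hb) (by simp only; omega) _ (h b' hb')
      simp only at this
      omega

theorem exists_height_shape {p : DyckWord} {M : ℕ → ℕ} {D : Finset Tile}
    (hT : Tiles D (columnRegion p M)) (hD : CoverInclusive p D) {t : Tile} (ht : t ∈ D) :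
    ∃ k : ℕ, ∀ i ≤ t.width,
      t.y + height t.shape.toList i = height p.toList (t.x + i) + 1 + 2 * k := by
  have hb : ∀ i ≤ t.width, (t.x + i, t.y + height t.shape.toList i) ∈ t.boxes := fun i hi =>
    Tile.mem_boxes.2 ⟨i, hi, rfl, rfl⟩
  obtain ⟨k, -, hk⟩ := hT.1 t ht _ (hb 0 (Nat.zero_le _))
  exact ⟨k, fun i hi => level_eq_of_coverInclusive hT hD k t ht _ (hb 0 (Nat.zero_le _)) hk _
    (hb i hi)⟩

/-- The tile `t` has level `k` and crosses the step `j`. -/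
def Crosses (p : DyckWord) (t : Tile) (k j : ℕ) : Prop :=
  (∀ i ≤ t.width, t.y + height t.shape.toList i = height p.toList (t.x + i) + 1 + 2 * k) ∧
    t.x ≤ j ∧ j < t.x + t.width

/-- This is the converse of `IsCodedBy.tiles` and `IsCodedBy.coverInclusive`. Since tiles have
constant level, their shapes are pieces of `p`; as these pieces are Dyck paths, a tile that crosses
one step of a matched pair crosses the whole pair. -/
theorem exists_isCodedBy_of_coverInclusive {p : DyckWord} {M : ℕ → ℕ} {D : Finset Tile}
    (hM : ∀ x, p.toList.length ≤ x → M x = 0)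
    (hT : Tiles D (columnRegion p M)) (hD : CoverInclusive p D) :
    ∃ C, IsCode p C M ∧ IsCodedBy D p C M := by
  classical
  have hlevel := fun t (ht : t ∈ D) => exists_height_shape hT hD ht
  have hlt : ∀ t ∈ D, ∀ k : ℕ, (∀ i ≤ t.width,
      t.y + height t.shape.toList i = height p.toList (t.x + i) + 1 + 2 * k) →
      ∀ c, t.x ≤ c → c ≤ t.x + t.width → k < M c := by
    intro t ht k hk c h1 h2
    obtain ⟨k', h3, h4⟩ := hT.1 t ht _ ((Tile.mem_boxes_iff_of_height hk).2 ⟨h1, h2, rfl⟩)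
    simp only at h3 h4
    obtain rfl : k = k' := by omega
    exact h3
  have huniq : ∀ t ∈ D, ∀ s ∈ D, ∀ k : ℕ, (∀ i ≤ t.width,
      t.y + height t.shape.toList i = height p.toList (t.x + i) + 1 + 2 * k) →
      (∀ i ≤ s.width,
      s.y + height s.shape.toList i = height p.toList (s.x + i) + 1 + 2 * k) →
      ∀ c, t.x ≤ c → c ≤ t.x + t.width → s.x ≤ c → c ≤ s.x + s.width → t = s := by
    intro t ht s hs k hk hks c h1 h2 h3 h4
    have hbt := (Tile.mem_boxes_iff_of_height hk).2 ⟨h1, h2, rfl⟩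
    exact (hT.2 _ (hT.1 t ht _ hbt)).unique ⟨ht, hbt⟩
      ⟨hs, (Tile.mem_boxes_iff_of_height hks).2 ⟨h3, h4, rfl⟩⟩
  -- The levels on which a given step is crossed form an initial segment, so their number `C j`
  -- determines them.
  have hdown : ∀ j k, (∃ t ∈ D, Crosses p t (k + 1) j) → ∃ t ∈ D, Crosses p t k j := by
    rintro j k ⟨t, ht, hk, h1, h2⟩
    rcases hD t ht with h | ⟨s, hs, h⟩
    · have := h _ ((Tile.mem_boxes_iff_of_height hk).2 ⟨h1, h2.le, rfl⟩)
      simp only at this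
      push_cast at this
      omega
    · obtain ⟨k', hk'⟩ := hlevel s hs
      have h3 := (Tile.mem_boxes_iff_of_height hk').1
        (h _ ((Tile.mem_boxes_iff_of_height hk).2 ⟨h1, h2.le, rfl⟩))
      have h4 := (Tile.mem_boxes_iff_of_height hk').1
        (h _ ((Tile.mem_boxes_iff_of_height hk).2
          ⟨show t.x ≤ j + 1 by omega, show j + 1 ≤ t.x + t.width by omega, rfl⟩))
      obtain rfl : k' = k := by push_cast at h3; omega
      exact ⟨s, hs, hk', h3.1, by omega⟩
  have hex : ∀ j, ∃ k, ¬ ∃ t ∈ D, Crosses p t k j := fun j => ⟨M j, by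
    rintro ⟨t, ht, hk, h1, h2⟩
    exact lt_irrefl _ (hlt t ht _ hk j h1 h2.le)⟩
  set C : ℕ → ℕ := fun j => Nat.find (hex j) with hC
  have hCiff : ∀ j k, k < C j ↔ ∃ t ∈ D, Crosses p t k j := by
    intro j k
    refine ⟨fun h => not_not.1 (Nat.find_min (hex j) h), fun h => ?_⟩
    by_contra hc
    have hne := Nat.find_spec (hex j)
    apply hne
    change ¬ k < Nat.find (hex j) at hc
    generalize Nat.find (hex j) = k' at hc ⊢
    obtain ⟨d, rfl⟩ := Nat.exists_eq_add_of_le (not_lt.1 hc)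
    clear hc hne
    induction d with
    | zero => exact h
    | succ d ih => exact ih (hdown _ _ h)
  have hmin : ∀ t ∈ D, ∀ c, t.x ≤ c → c ≤ t.x + t.width →
      height p.toList t.x ≤ height p.toList c := by
    intro t ht c h1 h2
    obtain ⟨k, hk⟩ := hlevel t ht
    have h3 := hk (c - t.x) (by omega)
    have h4 := hk 0 (Nat.zero_le _)
    rw [Nat.add_sub_cancel' h1] at h3
    rw [height_zero, add_zero, add_zero] at h4
    have := height_nonneg t.shape (c - t.x)
    omega
  have hend : ∀ t ∈ D, height p.toList (t.x + t.width) = height p.toList t.x := by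
    intro t ht
    obtain ⟨k, hk⟩ := hlevel t ht
    have h3 := hk t.width le_rfl
    have h4 := hk 0 (Nat.zero_le _)
    rw [height_of_length_le t.shape (x := t.width) le_rfl] at h3
    rw [height_zero, add_zero, add_zero] at h4
    omega
  -- A tile ending inside the edge would end above its lowest height, which is impossible for a Dyck
  -- shape. The next claim is the mirror image.
  have hup : ∀ (e : Edge p), ∀ t ∈ D, t.x ≤ e.up → e.up < t.x + t.width →
      e.down < t.x + t.width := by
    intro e t ht h1 h2
    by_contra hc
    have h3 := e.height_ge h2 (by omega)
    have h4 := hmin t ht e.up h1 h2.le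
    rw [hend t ht] at h3
    omega
  have hdn : ∀ (e : Edge p), ∀ t ∈ D, t.x ≤ e.down → e.down < t.x + t.width →
      t.x ≤ e.up := by
    intro e t ht h1 h2
    by_contra hc
    have h3 := e.height_ge (k := t.x) (by omega) h1
    have h4 := hmin t ht (e.down + 1) (by omega) (by omega)
    rw [e.height_down_succ] at h4
    omega
  refine ⟨C, ⟨?_, ?_, ?_, ?_⟩, ?_⟩
  · intro e
    refine eq_of_forall_lt_iff fun k => ?_
    rw [hCiff, hCiff]
    have := e.up_lt_down
    exact ⟨fun ⟨t, ht, hk, h1, h2⟩ => ⟨t, ht, hk, by omega, hup e t ht h1 h2⟩,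
      fun ⟨t, ht, hk, h1, h2⟩ => ⟨t, ht, hk, hdn e t ht h1 h2, by omega⟩⟩
  · intro e j h3 h4
    refine le_of_forall_lt fun k => ?_
    rw [hCiff, hCiff]
    rintro ⟨t, ht, hk, h1, h2⟩
    have := hup e t ht h1 h2
    exact ⟨t, ht, hk, by omega, by omega⟩
  · intro e x h3 h4
    refine le_of_forall_lt fun k => ?_
    rw [hCiff]
    rintro ⟨t, ht, hk, h1, h2⟩
    have := hup e t ht h1 h2
    exact hlt t ht k hk x (by omega) (by omega)
  · intro j hj
    by_contra hc
    obtain ⟨t, ht, hk, h1, h2⟩ := (hCiff j 0).1 (by omega)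
    have := hlt t ht 0 hk j h1 h2.le
    rw [hM j hj] at this
    omega
  · have hof : ∀ t ∈ D, ∀ k : ℕ, (∀ i ≤ t.width,
        t.y + height t.shape.toList i = height p.toList (t.x + i) + 1 + 2 * k) →
        IsTileOf p C M t k := by
      intro t ht k hk
      have hy := hk 0 (Nat.zero_le _)
      rw [height_zero, add_zero, add_zero] at hy
      refine ⟨hy, hlt t ht k hk _ le_rfl (by omega), ?_, ?_, ?_, ?_⟩
      · intro j hj
        by_contra hc
        obtain ⟨s, hs, hks, h1, h2⟩ := (hCiff j k).1 (by omega)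
        have := huniq t ht s hs k hk hks t.x le_rfl (by omega) (by omega) (by omega)
        subst this
        omega
      · intro j h1 h2
        exact (hCiff j k).2 ⟨t, ht, hk, h1, h2⟩
      · by_contra hc
        obtain ⟨s, hs, hks, h1, h2⟩ := (hCiff _ k).1 (not_le.1 hc)
        have := huniq t ht s hs k hk hks _ (by omega) le_rfl h1 h2.le
        subst this
        omega
      · have hlen : t.x + t.width < p.toList.length := by
          by_contra hc
          have := hlt t ht k hk (t.x + t.width) (by omega) le_rfl
          rw [hM _ (by omega)] at this
          omega
        refine eq_of_height_eq ?_ fun i hi => ?_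
        · simp only [List.length_take, List.length_drop]
          change t.width = _
          omega
        · rw [height_take_drop _ _ (n := t.width) hi]
          have := hk i hi
          omega
    intro t
    constructor
    · intro ht
      obtain ⟨k, hk⟩ := hlevel t ht
      exact ⟨k, hof t ht k hk⟩
    · rintro ⟨k, hk⟩
      obtain ⟨s, ⟨hs, hb⟩, -⟩ := hT.2 (t.x, height p.toList t.x + 1 + 2 * k) ⟨k, hk.lt, rfl⟩
      obtain ⟨k', hk'⟩ := hlevel s hs
      have h1 := (Tile.mem_boxes_iff_of_height hk').1 hb
      obtain rfl : k' = k := by omega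
      rwa [hk.eq_of_overlap (hof s hs _ hk') le_rfl (by omega) h1.1 h1.2.1]

/-! ### Trajectories of an encoded tiling -/

/-- Every tile is the first one of a sequence of tiles that cannot be continued to the left. -/
theorem exists_chain (D : Finset Tile) {s : Tile} (hs : s ∈ D) :
    ∃ (l : List Tile) (f : Tile), (∀ t ∈ l, t ∈ D) ∧ l.head? = some s ∧ l.getLast? = some f ∧
      l.IsChain Attached ∧ ∀ t ∈ D, ¬ Attached f t := by
  induction hn : s.x using Nat.strong_induction_on generalizing s with
  | _ n ih =>
    by_cases h : ∃ t ∈ D, Attached s t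
    · obtain ⟨t, ht, hst⟩ := h
      obtain ⟨l, f, h1, h2, h3, h4, h5⟩ := ih t.x (by have := hst.1; omega) ht rfl
      rcases l with _ | ⟨a, l⟩
      · simp at h2
      · obtain rfl : a = t := by simpa using h2
        refine ⟨s :: a :: l, f, ?_, rfl, by simpa using h3, ?_, h5⟩
        · intro r hr
          rcases List.mem_cons.1 hr with rfl | hr
          · exact hs
          · exact h1 r hr
        · exact List.isChain_cons_cons.2 ⟨hst, h4⟩
    · refine ⟨[s], s, by simpa using hs, rfl, rfl, List.isChain_singleton _, ?_⟩
      intro t ht hst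
      exact h ⟨t, ht, hst⟩

/-- The level on which a trajectory leaves the step `x` to the left, if it reaches this step from
the right on the level `k` and no tile crosses the step there. -/
def nextLevel (p : DyckWord) (x k : ℕ) : ℕ :=
  if p.toList[x]? = some U then k + 1 else k

theorem nextLevel_of_up {p : DyckWord} {x : ℕ} (h : p.toList[x]? = some U) (k : ℕ) :
    nextLevel p x k = k + 1 := by simp [nextLevel, h]

theorem nextLevel_of_down {p : DyckWord} {x : ℕ} (h : p.toList[x]? = some D) (k : ℕ) :
    nextLevel p x k = k := by simp [nextLevel, h]

theorem le_nextLevel (p : DyckWord) (x k : ℕ) : k ≤ nextLevel p x k := by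
  unfold nextLevel; split <;> omega

/-- Twice the total `art` of the part of a trajectory to the left of its box of level `k` in the
column `x`, this box included; a non-trivial tile is counted once its leftmost box is reached. -/
def remaining (p : DyckWord) (C M : ℕ → ℕ) : ℕ → ℕ → ℕ
  | 0, _ => 2
  | x + 1, k => 1 + if k < C x then remaining p C M x k else
      1 + if nextLevel p x k < M x then remaining p C M x (nextLevel p x k) else 0

/-- Twice the Hermite history of an encoded tiling at the up step `u`. -/
def twiceHistory (p : DyckWord) (C M : ℕ → ℕ) (u : ℕ) : ℕ :=
  if C u < M u then remaining p C M u (C u) else 0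

theorem remaining_succ_of_lt {p : DyckWord} {C M : ℕ → ℕ} {x k : ℕ} (h : k < C x) :
    remaining p C M (x + 1) k = 1 + remaining p C M x k := by
  rw [remaining, if_pos h]

theorem remaining_succ_of_ge {p : DyckWord} {C M : ℕ → ℕ} {x k : ℕ} (h : C x ≤ k) :
    remaining p C M (x + 1) k =
      2 + if nextLevel p x k < M x then remaining p C M x (nextLevel p x k) else 0 := by
  rw [remaining, if_neg (by omega), ← add_assoc]

theorem two_le_remaining (p : DyckWord) (C M : ℕ → ℕ) (x k : ℕ) : 2 ≤ remaining p C M x k := by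
  induction x with
  | zero => exact le_rfl
  | succ x ih =>
    rcases Nat.lt_or_ge k (C x) with h | h
    · rw [remaining_succ_of_lt h]; omega
    · rw [remaining_succ_of_ge h]; omega

/-! ### Levels along a trajectory -/

namespace IsTileOf

variable {p : DyckWord} {C M : ℕ → ℕ} {t t' : Tile} {k k' : ℕ}

theorem remaining_right (ht : IsTileOf p C M t k) :
    remaining p C M (t.x + t.width) k = t.width + remaining p C M t.x k := by
  have : ∀ i ≤ t.width, remaining p C M (t.x + i) k = i + remaining p C M t.x k := by
    intro i
    induction i with
    | zero => simp
    | succ i ih =>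
      intro hi
      rw [← add_assoc, remaining_succ_of_lt (ht.run _ (by omega) (by omega)), ih (by omega)]
      omega
  exact this _ le_rfl

theorem x_lt_length (hM : IsColumnHeight p M) (ht : IsTileOf p C M t k) :
    t.x < p.toList.length := by
  by_contra hc
  have := ht.lt
  rw [hM.eq_zero _ (by omega)] at this
  omega

/-- Attachment raises `y` by one between adjacent columns. On an up step of `p` the path falls by
one to the left, so the level rises by one; on a down step the two changes cancel. -/
theorem level_of_attached (h : IsCode p C M) (hM : IsColumnHeight p M) (ht : IsTileOf p C M t k)
    (ht' : IsTileOf p C M t' k') (ha : Attached t t') :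
    k' = nextLevel p (t'.x + t'.width) k := by
  obtain ⟨h1, h2⟩ := ha
  have h3 := ht.x_lt_length hM
  have h4 := ht'.height_right h
  rw [ht.y_eq, ht'.y_eq, ← h4, ← h1] at h2
  rcases getElem?_cases_of_lt (show t'.x + t'.width < p.toList.length by omega) with h5 | h5
  · rw [nextLevel_of_up h5]
    rw [height_succ_of_U h5] at h2
    omega
  · rw [nextLevel_of_down h5]
    rw [height_succ_of_D h5] at h2
    omega

theorem exists_attached {D : Finset Tile} (hD : IsCodedBy D p C M) (h : IsCode p C M)
    (hM : IsColumnHeight p M) (ht : IsTileOf p C M t k) {c : ℕ} (hc : c + 1 = t.x)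
    (hk : nextLevel p c k < M c) : ∃ t' ∈ D, Attached t t' := by
  obtain ⟨t', ht', hk', h1, h2⟩ := hD.exists_mem h hk
  have h3 := ht.left c hc
  have h3' := le_nextLevel p c k
  have h4 : t'.x + t'.width = c := by
    by_contra hne
    have := hk'.run c h1 (by omega)
    omega
  refine ⟨t', ht', by omega, ?_⟩
  have h6 := ht.x_lt_length hM
  rw [hk'.y_eq, ht.y_eq, ← hk'.height_right h, h4, ← hc]
  rcases getElem?_cases_of_lt (show c < p.toList.length by omega) with h5 | h5
  · rw [nextLevel_of_up h5, height_succ_of_U h5]; push_cast; ring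
  · rw [nextLevel_of_down h5, height_succ_of_D h5]; ring

/-- The unfolding of `remaining` follows the chain: crossed steps add the width of a tile, an
uncrossed step passes to the next tile, and the recursion stops where no tile can be attached, or in
column `0`. -/
theorem chain_art_sum {D : Finset Tile} (hD : IsCodedBy D p C M) (h : IsCode p C M)
    (hM : IsColumnHeight p M) (ht : IsTileOf p C M t k) {l : List Tile} {f : Tile}
    (hl : ∀ s ∈ t :: l, s ∈ D) (hlast : (t :: l).getLast? = some f)
    (hchain : (t :: l).IsChain Attached) (hf : ∀ s ∈ D, ¬ Attached f s) :
    2 * ((t :: l).map Tile.art).sum = remaining p C M (t.x + t.width) k := by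
  induction l generalizing t k with
  | nil =>
    obtain rfl : t = f := by simpa using hlast
    rw [ht.remaining_right]
    simp only [List.map_cons, List.map_nil, List.sum_cons, List.sum_nil, add_zero, t.two_mul_art]
    congr 1
    rcases hx : t.x with _ | c
    · rfl
    · rw [remaining_succ_of_ge (ht.left c hx.symm), if_neg]
      intro hk
      obtain ⟨s, hs, ha⟩ := ht.exists_attached hD h hM hx.symm hk
      exact hf s hs ha
  | cons t' l ih =>
    obtain ⟨ha, hchain⟩ := List.isChain_cons_cons.1 hchain
    obtain ⟨k', hk'⟩ := (hD t').1 (hl t' (by simp))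
    have hlev := ht.level_of_attached h hM hk' ha
    have hsum := ih hk' (fun s hs => hl s (List.mem_cons_of_mem _ hs)) (by simpa using hlast)
      hchain
    have hlt := hk'.lt_of_mem h (show t'.x ≤ t'.x + t'.width by omega) le_rfl
    rw [List.map_cons, List.sum_cons, mul_add, hsum, t.two_mul_art, ht.remaining_right, ← ha.1,
      remaining_succ_of_ge (ht.left _ ha.1), ← hlev, if_pos hlt]
    omega

/-- A tile that ends at the up step of `e` is the first one of a trajectory if and only if
its level is `C e.up`. -/
theorem maximal_right_iff {D : Finset Tile} (hD : IsCodedBy D p C M) (h : IsCode p C M)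
    (hM : IsColumnHeight p M) (ht : IsTileOf p C M t k) {e : Edge p} (he : AssociatedWith t e) :
    (∀ s ∈ D, ¬ Attached s t) ↔ k = C e.up := by
  change t.x + t.width = e.up at he
  have hr := ht.right
  rw [he] at hr
  constructor
  · intro hmax
    by_contra hne
    obtain ⟨k, rfl⟩ : ∃ k', k = k' + 1 := ⟨k - 1, by omega⟩
    -- Above level `C e.up`, the bound on `M` along an up step leaves a box of level one lower in
    -- the next column. The tile of this box cannot cross the step, so it starts there and is
    -- attached to `t`.
    have h1 := hM.le_of_up _ e.getElem?_up
    have h2 := ht.lt_of_mem h (show t.x ≤ e.up by omega) (by omega)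
    obtain ⟨s, hs, hk, h3, h4⟩ := hD.exists_mem h (show k < M (e.up + 1) by omega)
    have h5 : s.x = e.up + 1 := by
      by_contra hc
      have := hk.run e.up (by omega) (by omega)
      omega
    refine hmax s hs ⟨by omega, ?_⟩
    rw [ht.y_eq, hk.y_eq, h5, e.height_up_succ, ← ht.height_right h, he]
    push_cast; ring
  · rintro rfl s hs ha
    obtain ⟨k', hk'⟩ := (hD s).1 hs
    have h1 := hk'.level_of_attached h hM ht ha
    have h2 := hk'.left _ ha.1
    rw [he] at h1 h2
    rw [nextLevel_of_up e.getElem?_up] at h1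
    omega

end IsTileOf

/-- Every trajectory at `e.up` starts with a tile of level `C e.up`, and it exists exactly when the
column has a box of that level. The factor two avoids halves in the recursion. -/
theorem isHermiteHistory_iff {p : DyckWord} {C M : ℕ → ℕ} {D : Diagram} {H : Edge p → ℕ}
    (hD : IsCodedBy D.tiles p C M) (h : IsCode p C M) (hM : IsColumnHeight p M) :
    IsHermiteHistory D H ↔ ∀ e : Edge p, 2 * H e = twiceHistory p C M e.up := by
  have hsum : ∀ (e : Edge p) l s f, IsTrajectory D.tiles l s f → AssociatedWith s e →
      2 * (l.map Tile.art).sum = twiceHistory p C M e.up := by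
    intro e l s f hl hs
    have hhead := hl.head
    rcases l with _ | ⟨a, l⟩
    · simp at hhead
    obtain rfl : a = s := by simpa using hhead
    obtain ⟨k, hk⟩ := (hD a).1 (hl.mem a (by simp))
    obtain rfl := (hk.maximal_right_iff hD h hM hs).1 hl.maximal_right
    have hlt := hk.lt_of_mem h (show a.x ≤ a.x + a.width by omega) le_rfl
    have hs' : a.x + a.width = e.up := hs
    rw [hk.chain_art_sum hD h hM hl.mem hl.last hl.chain hl.maximal_left]
    rw [hs'] at hlt ⊢
    rw [twiceHistory, if_pos hlt]
  have hex : ∀ e : Edge p,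
      (∃ l s f, IsTrajectory D.tiles l s f ∧ AssociatedWith s e) ↔ C e.up < M e.up := by
    intro e
    constructor
    · rintro ⟨l, s, f, hl, hs⟩
      have hhead := hl.head
      obtain ⟨k, hk⟩ := (hD s).1 (hl.mem s (List.mem_of_head? hhead))
      obtain rfl := (hk.maximal_right_iff hD h hM hs).1 hl.maximal_right
      have hs' : s.x + s.width = e.up := hs
      have hlt := hk.lt_of_mem h (show s.x ≤ s.x + s.width by omega) le_rfl
      rwa [hs'] at hlt
    · intro hlt
      obtain ⟨s, hs, hk, h1, h2⟩ := hD.exists_mem h hlt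
      have he : AssociatedWith s e := by
        by_contra hne
        change ¬ s.x + s.width = e.up at hne
        have := hk.run e.up h1 (by omega)
        omega
      obtain ⟨l, f, h3, h4, h5, h6, h7⟩ := exists_chain D.tiles hs
      exact ⟨l, s, f, ⟨h3, h4, h5, h6, (hk.maximal_right_iff hD h hM he).2 rfl, h7⟩, he⟩
  constructor
  · intro hH e
    by_cases he : ∃ l s f, IsTrajectory D.tiles l s f ∧ AssociatedWith s e
    · obtain ⟨l, s, f, hl, hs⟩ := he
      rw [(hH e).1 l s f hl hs, hsum e l s f hl hs]
    · rw [(hH e).2 he, twiceHistory, if_neg (fun hc => he ((hex e).2 hc))]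
  · intro hH e
    refine ⟨fun l s f hl hs => ?_, fun he => ?_⟩
    · have := hsum e l s f hl hs
      have := hH e
      omega
    · have h1 := hH e
      rw [twiceHistory, if_neg (fun hc => he ((hex e).2 hc))] at h1
      omega

/-! ### The tiling of the region `R` -/

/-- Both sides are twice the number of up steps among the first `x` steps. -/
theorem Edge.card_up_lt (p : DyckWord) {x : ℕ} (hx : x ≤ p.toList.length) :
    (x : ℤ) + height p.toList x =
      2 * ((Finset.univ.filter fun e : Edge p => e.up < x).card : ℤ) := by
  induction x with
  | zero => simp [height_zero]
  | succ x ih =>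
    have ih := ih (by omega)
    rcases getElem?_cases_of_lt (show x < p.toList.length by omega) with h | h
    · obtain ⟨e, he⟩ := Edge.exists_up_eq h
      have h1 : (Finset.univ.filter fun e : Edge p => e.up < x + 1) =
          insert e (Finset.univ.filter fun e : Edge p => e.up < x) := by
        ext e'
        simp only [Finset.mem_filter, Finset.mem_univ, true_and, Finset.mem_insert]
        constructor
        · intro h'
          rcases Nat.lt_or_ge e'.up x with h2 | h2
          · exact .inr h2
          · exact .inl (Edge.up_injective (by omega))
        · rintro (rfl | h') <;> omega
      rw [h1, Finset.card_insert_of_notMem (by simp [he]), height_succ_of_U h]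
      push_cast; omega
    · have h1 : (Finset.univ.filter fun e : Edge p => e.up < x + 1) =
          (Finset.univ.filter fun e : Edge p => e.up < x) := by
        ext e'
        simp only [Finset.mem_filter, Finset.mem_univ, true_and]
        have : e'.up ≠ x := fun h' => by
          have := e'.getElem?_up; rw [h', h] at this; cases this
        omega
      rw [h1, height_succ_of_D h]
      push_cast; omega

theorem Edge.up_lt_length {p : DyckWord} (e : Edge p) : e.up < p.toList.length :=
  e.up_lt_down.trans e.down_lt_length

theorem Edge.card (p : DyckWord) : Fintype.card (Edge p) = p.semilength := by
  have h := Edge.card_up_lt p le_rfl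
  have h1 : (Finset.univ.filter fun e : Edge p => e.up < p.toList.length) = Finset.univ :=
    Finset.filter_true_of_mem fun e _ => e.up_lt_length
  rw [h1, height_of_length_le p le_rfl, Finset.card_univ] at h
  have h2 := p.two_mul_semilength_eq_length
  omega

/-- The number of boxes of the region `R` in the column `x`. -/
def columnHeightR (p : DyckWord) (x : ℕ) : ℕ :=
  (Finset.univ.filter fun e : Edge p => x ≤ e.up).card

theorem columnHeightR_eq (p : DyckWord) {x : ℕ} (hx : x ≤ p.toList.length) :
    (x : ℤ) + height p.toList x + 2 * columnHeightR p x = 2 * p.semilength := by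
  rw [Edge.card_up_lt p hx, ← Edge.card, columnHeightR, ← Finset.card_univ,
    ← Finset.card_filter_add_card_filter_not (s := Finset.univ) (fun e : Edge p => e.up < x)]
  simp only [not_lt]
  push_cast; ring

theorem columnHeightR_eq_zero (p : DyckWord) {x : ℕ} (hx : p.toList.length ≤ x) :
    columnHeightR p x = 0 := by
  rw [columnHeightR, Finset.card_eq_zero, Finset.filter_eq_empty_iff]
  intro e _
  have := e.up_lt_length
  omega

theorem isColumnHeight_columnHeightR (p : DyckWord) : IsColumnHeight p (columnHeightR p) where
  le_of_up x h := by
    have h1 := lt_length_of_getElem? h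
    have h2 := columnHeightR_eq p h1.le
    have h3 := columnHeightR_eq p (x := x + 1) h1
    rw [height_succ_of_U h] at h3
    push_cast at h3
    omega
  eq_zero x hx := columnHeightR_eq_zero p hx

theorem regionR_eq (p : DyckWord) : regionR p = columnRegion p (columnHeightR p) := by
  have hlen := p.two_mul_semilength_eq_length
  ext ⟨x, y⟩
  simp only [regionR, columnRegion, Set.mem_ofPred_eq]
  by_cases hx : x ≤ p.toList.length
  · obtain ⟨r, hr⟩ := height_parity p.toList hx
    have h1 := columnHeightR_eq p hx
    constructor
    · rintro ⟨⟨s, hs⟩, h2, h3⟩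
      -- With `h` the height at `x`, `x = h + 2r` and `x + y = 2s + 1` give `(y - h - 1) / 2 = s - r
      -- - h`.
      refine ⟨(s - r - height p.toList x).toNat, ?_, ?_⟩ <;> omega
    · rintro ⟨k, h2, h3⟩
      exact ⟨⟨height p.toList x + r + k, by omega⟩, by omega, by omega⟩
  · rw [columnHeightR_eq_zero p (by omega), height_of_length_le p (by omega)]
    constructor
    · rintro ⟨-, h2, h3⟩; omega
    · rintro ⟨k, h2, -⟩; omega

/-- The function on the steps of `p` whose values on both steps of an edge `e` are `f e`. -/
def edgeCode {p : DyckWord} (f : Edge p → ℕ) (j : ℕ) : ℕ :=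
  ∑ e ∈ Finset.univ.filter fun e : Edge p => e.up = j ∨ e.down = j, f e

theorem edgeCode_up {p : DyckWord} (f : Edge p → ℕ) (e : Edge p) : edgeCode f e.up = f e := by
  have : (Finset.univ.filter fun e' : Edge p => e'.up = e.up ∨ e'.down = e.up) = {e} := by
    ext e'
    simp only [Finset.mem_filter, Finset.mem_univ, true_and, Finset.mem_singleton]
    refine ⟨fun h => ?_, fun h => by simp [h]⟩
    rcases h with h | h
    · exact Edge.up_injective h
    · exact absurd h.symm (Edge.up_ne_down e e')
  rw [edgeCode, this, Finset.sum_singleton]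

theorem edgeCode_down {p : DyckWord} (f : Edge p → ℕ) (e : Edge p) :
    edgeCode f e.down = f e := by
  have : (Finset.univ.filter fun e' : Edge p => e'.up = e.down ∨ e'.down = e.down) = {e} := by
    ext e'
    simp only [Finset.mem_filter, Finset.mem_univ, true_and, Finset.mem_singleton]
    refine ⟨fun h => ?_, fun h => by simp [h]⟩
    rcases h with h | h
    · exact absurd h (Edge.up_ne_down e' e)
    · exact Edge.down_injective h
  rw [edgeCode, this, Finset.sum_singleton]

theorem edgeCode_eq_zero {p : DyckWord} (f : Edge p → ℕ) {j : ℕ} (hj : p.toList.length ≤ j) :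
    edgeCode f j = 0 := by
  rw [edgeCode, Finset.sum_eq_zero]
  intro e he
  have h1 := e.up_lt_length
  have h2 := e.down_lt_length
  have := (Finset.mem_filter.1 he).2
  omega

theorem IsCode.eq_edgeCode {p : DyckWord} {C M : ℕ → ℕ} (h : IsCode p C M) {f : Edge p → ℕ}
    (hf : ∀ e : Edge p, C e.up = f e) : C = edgeCode f := by
  funext j
  by_cases hj : j < p.toList.length
  · rcases Edge.exists_of_lt hj with ⟨e, rfl⟩ | ⟨e, rfl⟩
    · rw [edgeCode_up, hf]
    · rw [edgeCode_down, ← h.pair, hf]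
  · rw [h.eq_zero j (by omega), edgeCode_eq_zero f (by omega)]

/-- Because matched pairs do not cross, `nest` reduces to monotonicity along the tree order. -/
theorem isCode_edgeCode {p : DyckWord} {f : Edge p → ℕ} {M : ℕ → ℕ}
    (hmono : ∀ e e' : Edge p, IsAbove e e' → f e ≤ f e')
    (hle : ∀ (e : Edge p) (x : ℕ), e.up ≤ x → x ≤ e.down + 1 → f e ≤ M x) :
    IsCode p (edgeCode f) M where
  pair e := by rw [edgeCode_up, edgeCode_down]
  nest e j h1 h2 := by
    have key : ∀ e' : Edge p, e'.up = j ∨ e'.down = j → f e ≤ f e' := by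
      intro e' he'
      have h3 := e'.up_lt_down
      rcases lt_trichotomy e.up e'.up with h | h | h
      · rcases Edge.strictlyRight_or_isAbove h with h4 | h4
        · simp only [StrictlyRight] at h4; omega
        · exact hmono _ _ h4
      · rw [Edge.up_injective h]
      · rcases Edge.strictlyRight_or_isAbove h with h4 | h4
        · simp only [StrictlyRight] at h4; omega
        · have := h4.2; omega
    rcases Edge.exists_of_lt (show j < p.toList.length by have := e.down_lt_length; omega) with
      ⟨e', he'⟩ | ⟨e', he'⟩
    · rw [edgeCode_up, ← he', edgeCode_up]; exact key e' (.inl he')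
    · rw [edgeCode_up, ← he', edgeCode_down]; exact key e' (.inr he')
  le e x h1 h2 := by rw [edgeCode_up]; exact hle e x h1 h2
  eq_zero j hj := edgeCode_eq_zero f hj

section regionTiling

variable {p : DyckWord}

/-- Passing to a descendant enlarges both the set of smaller labels and the set of edges to the
right. The bound by `columnHeightR` holds because the counted edges have their up steps after
`e.down`. -/
theorem isCode_weakLabel (T₁ : NaturalLabel p) :
    IsCode p (edgeCode (weakLabel T₁)) (columnHeightR p) := by
  refine isCode_edgeCode (fun e e' h => ?_) (fun e x h1 h2 => ?_)
  · refine Finset.card_le_card (Finset.monotone_filter_right _ fun g _ hg => ?_)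
    exact ⟨hg.1.trans (T₁.increasing _ _ h), (h.2.trans hg.2 : e'.down < g.up)⟩
  · refine Finset.card_le_card (Finset.monotone_filter_right _ fun g _ hg => ?_)
    have : e.down < g.up := hg.2
    omega

theorem isRegionTiling_weakLabel_iff (T₁ : NaturalLabel p) (DR : Finset Tile) :
    IsRegionTiling p (weakLabel T₁) DR ↔
      IsCodedBy DR p (edgeCode (weakLabel T₁)) (columnHeightR p) := by
  constructor
  · rintro ⟨h1, h2, h3⟩
    rw [regionR_eq] at h1
    obtain ⟨C, hC, hD⟩ := exists_isCodedBy_of_coverInclusive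
      (isColumnHeight_columnHeightR p).eq_zero h1 h2
    rwa [← hC.eq_edgeCode fun e => by rw [← h3 e, hD.card_filter_nontrivialOver hC]]
  · intro hD
    have hC := isCode_weakLabel T₁
    refine ⟨?_, hD.coverInclusive hC, fun e => ?_⟩
    · rw [regionR_eq]; exact hD.tiles hC
    · rw [hD.card_filter_nontrivialOver hC, edgeCode_up]

theorem existsUnique_isRegionTiling (T₁ : NaturalLabel p) :
    ∃! DR : Finset Tile, IsRegionTiling p (weakLabel T₁) DR := by
  obtain ⟨D, hD⟩ := exists_isCodedBy p (edgeCode (weakLabel T₁))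
    (isColumnHeight_columnHeightR p).eq_zero
  refine ⟨D, (isRegionTiling_weakLabel_iff T₁ D).2 hD, fun D' hD' => ?_⟩
  have hD' := (isRegionTiling_weakLabel_iff T₁ D').1 hD'
  ext t
  rw [hD t, hD' t]

/-! ### The anchor sequence -/

/-- The number of edges with up step in the columns from `x` on and with a smaller label
than `e`. -/
def rank (T₁ : NaturalLabel p) (e : Edge p) (x : ℕ) : ℕ :=
  (Finset.univ.filter fun e' : Edge p => x ≤ e'.up ∧ T₁.label e' < T₁.label e).card

theorem rank_zero (T₁ : NaturalLabel p) (e : Edge p) : rank T₁ e 0 = T₁.label e := by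
  rw [← Fin.card_Iio, rank]
  refine Finset.card_equiv T₁.label fun e' => ?_
  simp

/-- The edge `e` is counted on the right and not on the left. So the trajectory of `e` always finds
a box on the level `rank`. -/
theorem rank_lt (T₁ : NaturalLabel p) {e : Edge p} {x : ℕ} (hx : x ≤ e.up) :
    rank T₁ e x < columnHeightR p x := by
  refine Finset.card_lt_card ((Finset.ssubset_iff_of_subset fun g hg => ?_).2 ⟨e, ?_, ?_⟩)
  · simp only [Finset.mem_filter, Finset.mem_univ, true_and] at hg ⊢
    exact hg.1
  · simpa using hx
  · simp

theorem rank_of_down (T₁ : NaturalLabel p) (e : Edge p) {x : ℕ} (hx : p.toList[x]? = some D) :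
    rank T₁ e x = rank T₁ e (x + 1) := by
  rw [rank, rank]
  congr 1
  ext g
  simp only [Finset.mem_filter, Finset.mem_univ, true_and]
  have : g.up ≠ x := fun h' => by
    have := g.getElem?_up; rw [h', hx] at this; cases this
  omega

theorem rank_up_of_lt (T₁ : NaturalLabel p) {e g : Edge p} (h : T₁.label g < T₁.label e) :
    rank T₁ e g.up = rank T₁ e (g.up + 1) + 1 := by
  rw [rank, rank]
  have : (Finset.univ.filter fun e' : Edge p => g.up ≤ e'.up ∧ T₁.label e' < T₁.label e) =
      insert g (Finset.univ.filter fun e' : Edge p =>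
        g.up + 1 ≤ e'.up ∧ T₁.label e' < T₁.label e) := by
    ext e'
    simp only [Finset.mem_filter, Finset.mem_univ, true_and, Finset.mem_insert]
    constructor
    · intro h'
      rcases h'.1.eq_or_lt with h2 | h2
      · exact .inl (Edge.up_injective h2.symm)
      · exact .inr ⟨h2, h'.2⟩
    · rintro (rfl | h')
      · exact ⟨le_rfl, h⟩
      · exact ⟨by omega, h'.2⟩
  rw [this, Finset.card_insert_of_notMem (by simp)]

theorem rank_up_of_le (T₁ : NaturalLabel p) {e g : Edge p} (h : T₁.label e ≤ T₁.label g) :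
    rank T₁ e g.up = rank T₁ e (g.up + 1) := by
  rw [rank, rank]
  congr 1
  ext e'
  simp only [Finset.mem_filter, Finset.mem_univ, true_and]
  constructor
  · rintro ⟨h1, h2⟩
    refine ⟨h1.lt_of_ne fun h3 => ?_, h2⟩
    rw [Edge.up_injective h3] at h
    exact absurd h2 (not_lt.2 h)
  · rintro ⟨h1, h2⟩
    exact ⟨by omega, h2⟩

/-- The later up steps belong to edges strictly to the right or to descendants, and descendants have
larger labels. So the trajectory of `e` starts on the level `rank`. -/
theorem weakLabel_eq_rank (T₁ : NaturalLabel p) (e : Edge p) :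
    weakLabel T₁ e = rank T₁ e e.up := by
  rw [rank_up_of_le T₁ le_rfl, weakLabel, rank]
  congr 1
  ext g
  simp only [Finset.mem_filter, Finset.mem_univ, true_and]
  have := e.up_lt_down
  constructor
  · rintro ⟨h1, h2⟩
    have : e.down < g.up := h2
    exact ⟨by omega, h1⟩
  · rintro ⟨h1, h2⟩
    rcases Edge.strictlyRight_or_isAbove h1 with h3 | h3
    · exact ⟨h2, h3⟩
    · exact absurd (T₁.increasing _ _ h3) h2.asymm

/-- Both numbers count labels below a threshold among the edges with up step after `g.up`, so they
are compared through nested sets; when `e` has the smaller label, `e` itself makes the inclusion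
strict. Hence the trajectory of `e` is on a crossed level at `g.up` exactly if `g` does not
contribute to its rank. -/
theorem rank_lt_weakLabel_iff (T₁ : NaturalLabel p) {e g : Edge p} (h : g.up < e.up) :
    rank T₁ e (g.up + 1) < weakLabel T₁ g ↔ T₁.label e < T₁.label g := by
  rw [weakLabel_eq_rank, rank_up_of_le T₁ le_rfl]
  constructor
  · intro h1
    by_contra hc
    refine absurd h1 (not_lt.2 (Finset.card_le_card ?_))
    refine Finset.monotone_filter_right _ fun g' _ hg' => ⟨hg'.1, hg'.2.trans_le (not_lt.1 hc)⟩
  · intro h1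
    refine Finset.card_lt_card ((Finset.ssubset_iff_of_subset fun g' hg' => ?_).2 ⟨e, ?_, ?_⟩)
    · simp only [Finset.mem_filter, Finset.mem_univ, true_and] at hg' ⊢
      exact ⟨hg'.1, hg'.2.trans h1⟩
    · simpa using ⟨h, h1⟩
    · simp

theorem IsTileOf.rank_left {T₁ : NaturalLabel p} {t : Tile} {e : Edge p}
    (ht : IsTileOf p (edgeCode (weakLabel T₁)) (columnHeightR p) t
      (rank T₁ e (t.x + t.width))) (he : t.x + t.width ≤ e.up) :
    rank T₁ e t.x = rank T₁ e (t.x + t.width) := by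
  have : ∀ i ≤ t.width, rank T₁ e (t.x + (t.width - i)) = rank T₁ e (t.x + t.width) := by
    intro i
    induction i with
    | zero => simp
    | succ i ih =>
      intro hi
      have ih := ih (by omega)
      have hrun := ht.run (t.x + (t.width - (i + 1))) (by omega) (by omega)
      rw [← ih, show t.x + (t.width - i) = t.x + (t.width - (i + 1)) + 1 by omega] at hrun
      rw [← ih, show t.x + (t.width - i) = t.x + (t.width - (i + 1)) + 1 by omega]
      have hlen := e.up_lt_length
      rcases getElem?_cases_of_lt (show t.x + (t.width - (i + 1)) < p.toList.length by omega)
        with h | h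
      · obtain ⟨g, hg⟩ := Edge.exists_up_eq h
        have hge : g.up < e.up := by omega
        rw [← hg, edgeCode_up, rank_lt_weakLabel_iff T₁ hge] at hrun
        rw [← hg, rank_up_of_le T₁ hrun.le]
      · exact rank_of_down T₁ e h
  simpa using this t.width le_rfl

/-- An uncrossed up step belongs to an edge with a smaller label than `e`, which enters the rank
just as the trajectory gains a level. -/
theorem rank_eq_nextLevel (T₁ : NaturalLabel p) {e : Edge p} {c : ℕ} (hc : c < e.up)
    (h : edgeCode (weakLabel T₁) c ≤ rank T₁ e (c + 1)) :
    rank T₁ e c = nextLevel p c (rank T₁ e (c + 1)) := by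
  have hlen := e.up_lt_length
  rcases getElem?_cases_of_lt (show c < p.toList.length by omega) with h1 | h1
  · obtain ⟨g, rfl⟩ := Edge.exists_up_eq h1
    rw [nextLevel_of_up h1]
    rw [edgeCode_up, ← not_lt, rank_lt_weakLabel_iff T₁ hc, not_lt] at h
    refine rank_up_of_lt T₁ (h.lt_of_ne fun h2 => ?_)
    rw [T₁.label.injective h2] at hc
    omega
  · rw [nextLevel_of_down h1, rank_of_down T₁ e h1]

/-- The level stays equal to `rank` along the chain. As `rank` is below the column height, the chain
cannot stop before column `0`. -/
theorem IsTileOf.chain_last {T₁ : NaturalLabel p} {D : Finset Tile}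
    (hD : IsCodedBy D p (edgeCode (weakLabel T₁)) (columnHeightR p)) {t : Tile} {e : Edge p}
    (ht : IsTileOf p (edgeCode (weakLabel T₁)) (columnHeightR p) t
      (rank T₁ e (t.x + t.width))) (he : t.x + t.width ≤ e.up) {l : List Tile} {f : Tile}
    (hl : ∀ s ∈ t :: l, s ∈ D) (hlast : (t :: l).getLast? = some f)
    (hchain : (t :: l).IsChain Attached) (hf : ∀ s ∈ D, ¬ Attached f s) :
    f.x = 0 ∧ f.y = 1 + 2 * (T₁.label e : ℕ) := by
  have hC := isCode_weakLabel T₁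
  have hM := isColumnHeight_columnHeightR p
  have hr := ht.rank_left he
  induction l generalizing t with
  | nil =>
    obtain rfl : t = f := by simpa using hlast
    rcases hx : t.x with _ | c
    · refine ⟨rfl, ?_⟩
      rw [ht.y_eq, ← hr, hx, height_zero, rank_zero]
      ring
    · have h1 := ht.left c hx.symm
      have h2 := rank_eq_nextLevel T₁ (e := e) (c := c) (by omega) (by rw [← hx, hr]; exact h1)
      rw [← hx, hr] at h2
      obtain ⟨s, hs, ha⟩ := ht.exists_attached hD hC hM hx.symm
        (by rw [← h2]; exact rank_lt T₁ (by omega))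
      exact absurd ha (hf s hs)
  | cons t' l ih =>
    obtain ⟨ha, hchain⟩ := List.isChain_cons_cons.1 hchain
    obtain ⟨k', hk'⟩ := (hD t').1 (hl t' (by simp))
    have hlev := ht.level_of_attached hC hM hk' ha
    have h1 := ht.left _ ha.1
    have h2 := rank_eq_nextLevel T₁ (e := e) (c := t'.x + t'.width) (by have := ha.1; omega)
      (by rw [ha.1, hr]; exact h1)
    rw [ha.1, hr, ← hlev] at h2
    rw [← h2] at hk'
    have he' : t'.x + t'.width ≤ e.up := by have := ha.1; omega
    exact ih hk' he' (fun s hs => hl s (List.mem_cons_of_mem _ hs)) (by simpa using hlast)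
      hchain (hk'.rank_left he')

theorem isAnchorSequence_iff {T₁ : NaturalLabel p} {D : Finset Tile}
    (hD : IsRegionTiling p (weakLabel T₁) D) (a : Edge p → Fin p.semilength) :
    IsAnchorSequence p D a ↔ a = fun e => (T₁.label e).rev := by
  rw [isRegionTiling_weakLabel_iff] at hD
  have hC := isCode_weakLabel T₁
  have hM := isColumnHeight_columnHeightR p
  constructor
  · intro ha
    funext e
    obtain ⟨l, s, f, hl, hs, -, hy⟩ := ha e
    have hhead := hl.head
    rcases l with _ | ⟨r, l⟩
    · simp at hhead
    obtain rfl : r = s := by simpa using hhead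
    obtain ⟨k, hk⟩ := (hD r).1 (hl.mem r (by simp))
    obtain rfl := (hk.maximal_right_iff hD hC hM hs).1 hl.maximal_right
    have hs' : r.x + r.width = e.up := hs
    rw [edgeCode_up, weakLabel_eq_rank, ← hs'] at hk
    have := (hk.chain_last hD hs'.le hl.mem hl.last hl.chain hl.maximal_left).2
    ext
    rw [Fin.val_rev]
    omega
  · rintro rfl e
    have hlt := rank_lt T₁ (le_refl e.up)
    obtain ⟨s, hs, hk, h1, h2⟩ := hD.exists_mem hC hlt
    have he : s.x + s.width = e.up := by
      by_contra hne
      have := hk.run e.up h1 (by omega)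
      rw [edgeCode_up, weakLabel_eq_rank] at this
      omega
    obtain ⟨l, f, h3, h4, h5, h6, h7⟩ := exists_chain D hs
    have hmax := (hk.maximal_right_iff hD hC hM (e := e) he).2
      (by rw [edgeCode_up, weakLabel_eq_rank])
    refine ⟨l, s, f, ⟨h3, h4, h5, h6, hmax, h7⟩, he, ?_⟩
    rcases l with _ | ⟨r, l⟩
    · simp at h4
    obtain rfl : r = s := by simpa using h4
    rw [← he] at hk
    obtain ⟨h8, h9⟩ := hk.chain_last hD he.le h3 h5 h6 h7
    refine ⟨h8, ?_⟩
    rw [h9, Fin.val_rev]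
    have := (T₁.label e).2
    omega

/-- The number of edges to the left of `e` with a larger label. -/
def inversions (T₁ : NaturalLabel p) (e : Edge p) : ℕ :=
  (Finset.univ.filter fun e' : Edge p => e'.up < e.up ∧ T₁.label e < T₁.label e').card

/-- The reversed label of `e` counts all larger labels, and the subtracted number counts those with
up step to the right of `e`. -/
theorem bSequence_rev (T₁ : NaturalLabel p) :
    bSequence (fun e => (T₁.label e).rev) = inversions T₁ := by
  funext e
  have h1 : (Finset.univ.filter fun e' : Edge p => T₁.label e < T₁.label e').card =
      p.semilength - 1 - T₁.label e := by
    rw [← Fin.card_Ioi]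
    exact Finset.card_equiv T₁.label fun e' => by simp
  have h2 := Finset.card_filter_add_card_filter_not
    (s := Finset.univ.filter fun e' : Edge p => T₁.label e < T₁.label e')
    (fun e' => e'.up < e.up)
  rw [bSequence, Finset.card_image_of_injective _
    (fun x y h => T₁.label.injective (Fin.rev_injective h)), inversions, Fin.val_rev]
  simp only [Fin.rev_lt_rev]
  rw [Finset.filter_filter, Finset.filter_filter, h1] at h2
  have h3 : (Finset.univ.filter fun e' : Edge p => T₁.label e < T₁.label e' ∧ ¬ e'.up < e.up) =
      Finset.univ.filter fun e' : Edge p => e.up < e'.up ∧ T₁.label e < T₁.label e' := by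
    ext e'
    simp only [Finset.mem_filter, Finset.mem_univ, true_and]
    constructor
    · rintro ⟨h3, h4⟩
      refine ⟨(not_lt.1 h4).lt_of_ne fun h5 => ?_, h3⟩
      rw [Edge.up_injective h5] at h3
      exact lt_irrefl _ h3
    · rintro ⟨h3, h4⟩
      exact ⟨h4, by omega⟩
  have h4 : (Finset.univ.filter fun e' : Edge p => T₁.label e < T₁.label e' ∧ e'.up < e.up) =
      Finset.univ.filter fun e' : Edge p => e'.up < e.up ∧ T₁.label e < T₁.label e' :=
    Finset.filter_congr fun _ _ => and_comm
  rw [h3, h4] at h2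
  omega

end regionTiling

/-! ### Dyck tilings between two Dyck paths -/

/-- `q` is a Dyck path of the same length as `p` and weakly above `p`. -/
structure IsUpperPath (p q : DyckWord) : Prop where
  length_eq : q.toList.length = p.toList.length
  le : ∀ x, height p.toList x ≤ height q.toList x

/-- The number of boxes between `p` and `q` in the column `x`. -/
def columnExcess (p q : DyckWord) (x : ℕ) : ℕ :=
  ((height q.toList x - height p.toList x) / 2).toNat

namespace IsUpperPath

variable {p q : DyckWord}

/-- Paths of equal length have heights of equal parity in each column, so halving the difference
loses nothing. -/
theorem height_eq (h : IsUpperPath p q) (x : ℕ) :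
    height q.toList x = height p.toList x + 2 * columnExcess p q x := by
  have h1 := h.le x
  rcases le_total x p.toList.length with hx | hx
  · obtain ⟨a, ha⟩ := height_parity p.toList hx
    obtain ⟨b, hb⟩ := height_parity q.toList (h.length_eq ▸ hx)
    unfold columnExcess
    omega
  · unfold columnExcess
    rw [height_of_length_le p hx, height_of_length_le q (h.length_eq ▸ hx)]
    simp

theorem isColumnHeight (h : IsUpperPath p q) : IsColumnHeight p (columnExcess p q) where
  le_of_up x hx := by
    have h1 := h.height_eq x
    have h2 := h.height_eq (x + 1)
    have h3 := lt_length_of_getElem? hx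
    rw [height_succ_of_U hx] at h2
    rcases getElem?_cases_of_lt (h.length_eq ▸ h3) with h4 | h4
    · rw [height_succ_of_U h4] at h2; omega
    · rw [height_succ_of_D h4] at h2; omega
  eq_zero x hx := by
    have h1 := h.height_eq x
    rw [height_of_length_le p hx, height_of_length_le q (h.length_eq ▸ hx)] at h1
    omega

theorem skewShape_eq (h : IsUpperPath p q) : skewShape p q = columnRegion p (columnExcess p q) := by
  ext ⟨x, y⟩
  simp only [skewShape, columnRegion, Set.mem_ofPred_eq]
  have h1 := h.height_eq x
  rcases le_total x p.toList.length with hx | hx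
  · obtain ⟨r, hr⟩ := height_parity p.toList hx
    constructor
    · rintro ⟨⟨s, hs⟩, h2, h3⟩
      refine ⟨(s - r - height p.toList x).toNat, ?_, ?_⟩ <;> omega
    · rintro ⟨k, h2, h3⟩
      exact ⟨⟨height p.toList x + r + k, by omega⟩, by omega, by omega⟩
  · rw [height_of_length_le p hx, height_of_length_le q (h.length_eq ▸ hx)] at *
    constructor
    · rintro ⟨-, h2, h3⟩; omega
    · rintro ⟨k, h2, -⟩; omega

end IsUpperPath

theorem isCoverInclusiveDyckTiling_iff {p : DyckWord} {D : Diagram} :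
    IsCoverInclusiveDyckTiling p D ↔ D.lower = p.toList ∧ ∃ q, D.upper = q.toList ∧
      IsUpperPath p q ∧ ∃ C, IsCode p C (columnExcess p q) ∧
        IsCodedBy D.tiles p C (columnExcess p q) := by
  constructor
  · rintro ⟨h1, ⟨q, h2, h3, h4, h5⟩, h6⟩
    have hq : IsUpperPath p q := ⟨h3, h4⟩
    rw [hq.skewShape_eq] at h5
    exact ⟨h1, q, h2, hq, exists_isCodedBy_of_coverInclusive hq.isColumnHeight.eq_zero h5 h6⟩
  · rintro ⟨h1, q, h2, hq, C, h3, h4⟩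
    exact ⟨h1, ⟨q, h2, hq.length_eq, hq.le, hq.skewShape_eq ▸ h4.tiles h3⟩, h4.coverInclusive h3⟩

/-! ### Insertion of a peak -/

/-- A word whose heights are nonnegative and end at `0` is a Dyck word. -/
def dyckWordOfHeight (l : List DyckStep) (h : ∀ i ≤ l.length, 0 ≤ height l i)
    (h0 : height l l.length = 0) : DyckWord where
  toList := l
  count_U_eq_count_D := by
    rw [height, List.take_length] at h0; omega
  count_D_le_count_U i := by
    rcases le_total i l.length with hi | hi
    · have := h i hi
      rw [height] at this; omega
    · rw [height, List.take_length] at h0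
      rw [List.take_of_length_le hi]; omega

/-- The index in `insertUD w m` of the step of `w` with index `j`. -/
def shift (m j : ℕ) : ℕ := if j < m then j else j + 2

theorem shift_of_lt {m j : ℕ} (h : j < m) : shift m j = j := if_pos h

theorem shift_of_le {m j : ℕ} (h : m ≤ j) : shift m j = j + 2 := if_neg (by omega)

theorem shift_lt_shift {m i j : ℕ} : shift m i < shift m j ↔ i < j := by
  unfold shift; split <;> split <;> omega

theorem shift_cases (m j : ℕ) : j = m ∨ j = m + 1 ∨ ∃ i, j = shift m i := by
  rcases Nat.lt_or_ge j m with h | h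
  · exact .inr (.inr ⟨j, (shift_of_lt h).symm⟩)
  · rcases Nat.lt_or_ge j (m + 2) with h' | h'
    · omega
    · exact .inr (.inr ⟨j - 2, by rw [shift_of_le (by omega)]; omega⟩)

section insertPeak

variable {p : DyckWord} {m : ℕ}

theorem getElem?_insertUD_shift (w : List DyckStep) (hm : m ≤ w.length) (j : ℕ) :
    (insertUD w m)[shift m j]? = w[j]? := by
  rcases Nat.lt_or_ge j m with h | h
  · rw [shift_of_lt h, getElem?_insertUD_of_lt w hm h]
  · rw [shift_of_le h, getElem?_insertUD_add_two w hm h]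

theorem height_insertUD_shift (w : List DyckStep) (hm : m ≤ w.length) (j : ℕ) :
    height (insertUD w m) (shift m j) = height w j := by
  rcases Nat.lt_or_ge j m with h | h
  · rw [shift_of_lt h, height_insertUD_of_le w hm h.le]
  · rw [shift_of_le h, height_insertUD_add_two w hm h]

theorem exists_peakEdge (hm : m ≤ p.toList.length) :
    ∃ e : Edge (insertPeak p m), e.up = m ∧ e.down = m + 1 := by
  refine Edge.exists_of_matched (by omega) (getElem?_insertUD_self _ hm)
    (getElem?_insertUD_succ _ hm) rfl fun k h1 h2 => ?_
  rw [show k = m + 1 by omega]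

theorem exists_liftEdge (hm : m ≤ p.toList.length) (e : Edge p) :
    ∃ e' : Edge (insertPeak p m), e'.up = shift m e.up ∧ e'.down = shift m e.down := by
  have hup : (insertUD p.toList m)[shift m e.up]? = some U := by
    rw [getElem?_insertUD_shift _ hm, e.getElem?_up]
  have hdown : (insertUD p.toList m)[shift m e.down]? = some D := by
    rw [getElem?_insertUD_shift _ hm, e.getElem?_down]
  have hh : height (insertUD p.toList m) (shift m e.up + 1) = height p.toList e.up + 1 := by
    rw [height_succ_of_U hup, height_insertUD_shift _ hm]
  refine Edge.exists_of_matched (shift_lt_shift.2 e.up_lt_down) hup hdown ?_ fun k h1 h2 => ?_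
  · change height (insertUD p.toList m) _ = height (insertUD p.toList m) _
    rw [hh, height_insertUD_shift _ hm, e.height_down]
  · change height (insertUD p.toList m) _ ≤ height (insertUD p.toList m) _
    rw [hh]
    rcases Nat.lt_or_ge m k with hk | hk
    · rcases Nat.lt_or_ge (m + 1) k with hk' | hk'
      · obtain ⟨i, rfl⟩ : ∃ i, k = i + 2 := ⟨k - 2, by omega⟩
        rw [height_insertUD_add_two _ hm (by omega)]
        rw [← shift_of_le (show m ≤ i by omega)] at h1 h2
        exact e.height_ge (shift_lt_shift.1 h1)
          (not_lt.1 fun h => absurd (shift_lt_shift.2 h) (not_lt.2 h2))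
      · obtain rfl : k = m + 1 := by omega
        rw [height_insertUD_succ _ hm]
        have := e.height_ge (k := m) (by unfold shift at h1; split at h1 <;> omega)
          (by unfold shift at h2; split at h2 <;> omega)
        omega
    · rw [height_insertUD_of_le _ hm hk]
      exact e.height_ge (by unfold shift at h1; split at h1 <;> omega)
        (by unfold shift at h2; split at h2 <;> omega)

/-- The edge of `insertPeak p m` formed by the inserted peak. -/
noncomputable def peakEdge (hm : m ≤ p.toList.length) : Edge (insertPeak p m) :=
  (exists_peakEdge hm).choose

/-- The edge of `insertPeak p m` that corresponds to an edge of `p`. -/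
noncomputable def liftEdge (hm : m ≤ p.toList.length) (e : Edge p) : Edge (insertPeak p m) :=
  (exists_liftEdge hm e).choose

theorem peakEdge_up (hm : m ≤ p.toList.length) : (peakEdge hm).up = m :=
  (exists_peakEdge hm).choose_spec.1

theorem peakEdge_down (hm : m ≤ p.toList.length) : (peakEdge hm).down = m + 1 :=
  (exists_peakEdge hm).choose_spec.2

theorem liftEdge_up (hm : m ≤ p.toList.length) (e : Edge p) :
    (liftEdge hm e).up = shift m e.up :=
  (exists_liftEdge hm e).choose_spec.1

theorem liftEdge_down (hm : m ≤ p.toList.length) (e : Edge p) :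
    (liftEdge hm e).down = shift m e.down :=
  (exists_liftEdge hm e).choose_spec.2

theorem edge_insertPeak_cases (hm : m ≤ p.toList.length) (e : Edge (insertPeak p m)) :
    e = peakEdge hm ∨ ∃ e' : Edge p, e = liftEdge hm e' := by
  rcases shift_cases m e.up with h | h | ⟨i, h⟩
  · exact .inl (Edge.up_injective (by rw [h, peakEdge_up]))
  · rw [← peakEdge_down hm] at h
    exact absurd h (Edge.up_ne_down _ _)
  · have h1 : (insertUD p.toList m)[e.up]? = some U := e.getElem?_up
    rw [h, getElem?_insertUD_shift _ hm] at h1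
    obtain ⟨e', rfl⟩ := Edge.exists_up_eq h1
    exact .inr ⟨e', Edge.up_injective (by rw [h, liftEdge_up])⟩

/-! ### Adding a peak to an encoded tiling -/

/-- The upper path after a spread at `x = m` and a strip-growth. -/
def raiseList (l : List DyckStep) (m : ℕ) : List DyckStep :=
  l.take m ++ U :: (l.drop m ++ [D])

theorem length_raiseList {l : List DyckStep} (hm : m ≤ l.length) :
    (raiseList l m).length = l.length + 2 := by
  simp [raiseList]; omega

theorem height_raiseList_of_le {l : List DyckStep} (hm : m ≤ l.length) {x : ℕ} (hx : x ≤ m) :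
    height (raiseList l m) x = height l x := by
  have : (raiseList l m).take x = l.take x := by
    rw [raiseList, List.take_append_of_le_length (by simp; omega), List.take_take, min_eq_left hx]
  simp [height, this]

theorem getElem?_raiseList_self {l : List DyckStep} (hm : m ≤ l.length) :
    (raiseList l m)[m]? = some U := by
  rw [raiseList, List.getElem?_append_right (by simp)]
  simp [min_eq_left hm]

theorem getElem?_raiseList_succ {l : List DyckStep} {j : ℕ} (hj : m ≤ j) (hl : j < l.length) :
    (raiseList l m)[j + 1]? = l[j]? := by
  rw [raiseList, List.getElem?_append_right (by simp; omega), List.length_take,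
    min_eq_left (by omega), show j + 1 - m = (j - m) + 1 by omega, List.getElem?_cons_succ,
    List.getElem?_append_left (by simp; omega), List.getElem?_drop, Nat.add_sub_cancel' hj]

theorem getElem?_raiseList_last {l : List DyckStep} (hm : m ≤ l.length) :
    (raiseList l m)[l.length + 1]? = some D := by
  rw [raiseList, List.getElem?_append_right (by simp), List.length_take,
    min_eq_left (by omega), show l.length + 1 - m = (l.length - m) + 1 by omega,
    List.getElem?_cons_succ, List.getElem?_append_right (by simp)]
  simp

theorem height_raiseList_succ {l : List DyckStep} {x : ℕ} (hm : m ≤ x) (hx : x ≤ l.length) :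
    height (raiseList l m) (x + 1) = height l x + 1 := by
  induction x, hm using Nat.le_induction with
  | base => rw [height_succ_of_U (getElem?_raiseList_self hx), height_raiseList_of_le hx le_rfl]
  | succ x hm ih =>
    have ih := ih (by omega)
    have h := getElem?_raiseList_succ (m := m) (l := l) (j := x) hm hx
    rcases getElem?_cases_of_lt (show x < l.length from hx) with a | a <;> rw [a] at h
    · rw [height_succ_of_U (x := x + 1) h, height_succ_of_U a, ih]
    · rw [height_succ_of_D (x := x + 1) h, height_succ_of_D a, ih]; ring

/-- The Dyck path with step sequence `raiseList q.toList m`. -/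
def raise (q : DyckWord) (m : ℕ) (hm : m ≤ q.toList.length) : DyckWord :=
  dyckWordOfHeight (raiseList q.toList m)
    (fun i hi => by
      rw [length_raiseList hm] at hi
      rcases Nat.lt_or_ge m i with h | h
      · obtain ⟨j, rfl⟩ : ∃ j, i = j + 1 := ⟨i - 1, by omega⟩
        rcases Nat.lt_or_ge q.toList.length j with hj | hj
        · obtain rfl : j = q.toList.length + 1 := by omega
          rw [height_succ_of_D (getElem?_raiseList_last hm), height_raiseList_succ hm le_rfl,
            height_of_length_le q le_rfl]
          decide
        · rw [height_raiseList_succ (by omega) hj]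
          have := height_nonneg q j
          omega
      · rw [height_raiseList_of_le hm h]; exact height_nonneg q i)
    (by
      rw [length_raiseList hm, height_succ_of_D (getElem?_raiseList_last hm),
        height_raiseList_succ hm le_rfl, height_of_length_le q le_rfl]
      rfl)

theorem raise_toList (q : DyckWord) (hm : m ≤ q.toList.length) :
    (raise q m hm).toList = raiseList q.toList m := rfl

variable {q : DyckWord}

theorem IsUpperPath.raise (h : IsUpperPath p q) (hm : m ≤ q.toList.length) :
    IsUpperPath (insertPeak p m) (raise q m hm) where
  length_eq := by
    rw [raise_toList, length_raiseList hm]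
    change _ = (insertUD p.toList m).length
    rw [length_insertUD, h.length_eq]
  le x := by
    have hm' : m ≤ p.toList.length := h.length_eq ▸ hm
    change height (insertUD p.toList m) x ≤ height (raiseList q.toList m) x
    rcases Nat.lt_or_ge m x with h1 | h1
    · rcases Nat.lt_or_ge (m + 1) x with h2 | h2
      · obtain ⟨j, rfl⟩ : ∃ j, x = j + 2 := ⟨x - 2, by omega⟩
        rw [height_insertUD_add_two _ hm' (by omega)]
        have h3 := h.le j
        rcases Nat.lt_or_ge j q.toList.length with hj | hj
        · rw [height_raiseList_succ (by omega) hj]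
          rcases getElem?_cases_of_lt hj with a | a
          · rw [height_succ_of_U a]; omega
          · rw [height_succ_of_D a]; omega
        · rw [height_of_length_le p (h.length_eq ▸ hj)]
          exact height_nonneg (DyckTiling.raise q m hm) _
      · obtain rfl : x = m + 1 := by omega
        rw [height_insertUD_succ _ hm', height_raiseList_succ le_rfl hm]
        have := h.le m
        omega
    · rw [height_insertUD_of_le _ hm' h1, height_raiseList_of_le hm h1]
      exact h.le x

theorem columnExcess_raise_of_le (hm : m ≤ p.toList.length) (hq : m ≤ q.toList.length) {x : ℕ}
    (hx : x ≤ m) : columnExcess (insertPeak p m) (raise q m hq) x = columnExcess p q x := by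
  change ((height (raiseList q.toList m) x - height (insertUD p.toList m) x) / 2).toNat = _
  rw [height_raiseList_of_le hq hx, height_insertUD_of_le _ hm hx, columnExcess]

theorem columnExcess_raise_succ (hm : m ≤ p.toList.length) (hq : m ≤ q.toList.length) :
    columnExcess (insertPeak p m) (raise q m hq) (m + 1) = columnExcess p q m := by
  change ((height (raiseList q.toList m) _ - height (insertUD p.toList m) _) / 2).toNat = _
  rw [height_raiseList_succ le_rfl hq, height_insertUD_succ _ hm, columnExcess,
    add_sub_add_right_eq_sub]

/-- The spread moves the column `x` to `x + 2`, and the strip-growth adds a box there exactly when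
the step of `q` leaving it is an up step. -/
theorem columnExcess_raise_add_two (h : IsUpperPath p q) (hq : m ≤ q.toList.length) {x : ℕ}
    (hx : m ≤ x) : columnExcess (insertPeak p m) (raise q m hq) (x + 2) =
      columnExcess p q x + if q.toList[x]? = some U then 1 else 0 := by
  have hm : m ≤ p.toList.length := h.length_eq ▸ hq
  have h0 := h.height_eq x
  have h1 := (h.raise hq).height_eq (x + 2)
  change height (raiseList q.toList m) _ = height (insertUD p.toList m) _ + _ at h1
  rw [height_insertUD_add_two _ hm hx] at h1
  rcases Nat.lt_or_ge x q.toList.length with hl | hl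
  · rw [height_raiseList_succ (by omega) hl] at h1
    rcases getElem?_cases_of_lt hl with a | a
    · rw [height_succ_of_U a] at h1
      simp only [a, if_true]
      omega
    · rw [height_succ_of_D a] at h1
      simp only [a, Option.some.injEq, reduceCtorEq, if_false]
      omega
  · rw [if_neg (by rw [List.getElem?_eq_none hl]; simp)]
    rw [(h.raise hq).isColumnHeight.eq_zero, h.isColumnHeight.eq_zero _ (h.length_eq ▸ hl)]
    change (insertUD p.toList m).length ≤ _
    rw [length_insertUD, ← h.length_eq]
    omega

/-- The same column is now compared with its right neighbour in the old tiling. In this form the new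
column heights obey the rule by which trajectories change level. -/
theorem columnExcess_raise_eq_nextLevel (h : IsUpperPath p q) (hq : m ≤ q.toList.length) {x : ℕ}
    (hx : m ≤ x) (hl : x < p.toList.length) :
    columnExcess (insertPeak p m) (raise q m hq) (x + 2) =
      nextLevel p x (columnExcess p q (x + 1)) := by
  have hm : m ≤ p.toList.length := h.length_eq ▸ hq
  have h0 := h.height_eq (x + 1)
  have h1 := (h.raise hq).height_eq (x + 2)
  change height (raiseList q.toList m) _ = height (insertUD p.toList m) _ + _ at h1
  rw [height_insertUD_add_two _ hm hx,
    height_raiseList_succ (by omega) (by rw [h.length_eq]; exact hl)] at h1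
  rcases getElem?_cases_of_lt hl with a | a
  · rw [nextLevel_of_up a]
    rw [height_succ_of_U a] at h0
    omega
  · rw [nextLevel_of_down a]
    rw [height_succ_of_D a] at h0
    omega

/-- The code of the tiling after a spread at `x = m` and a strip-growth. -/
def raiseCode (C M : ℕ → ℕ) (m j : ℕ) : ℕ :=
  if j < m then C j else if j < m + 2 then M m else C (j - 2)

variable {C M : ℕ → ℕ}

theorem raiseCode_shift (j : ℕ) : raiseCode C M m (shift m j) = C j := by
  rcases Nat.lt_or_ge j m with h | h
  · rw [shift_of_lt h, raiseCode, if_pos h]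
  · rw [shift_of_le h, raiseCode, if_neg (by omega), if_neg (by omega), Nat.add_sub_cancel]

theorem raiseCode_of_lt {j : ℕ} (h : j < m) : raiseCode C M m j = C j := if_pos h

theorem raiseCode_add_two {j : ℕ} (h : m ≤ j) : raiseCode C M m (j + 2) = C j := by
  rw [← shift_of_le h, raiseCode_shift]

theorem raiseCode_self : raiseCode C M m m = M m := by simp [raiseCode]

theorem raiseCode_succ : raiseCode C M m (m + 1) = M m := by simp [raiseCode]

/-- Every tile over the column `m` is cut and reconnected, so both inserted steps are crossed on all
`M m` levels. An old edge around the peak satisfies `nest` there because its code was bounded by `M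
m`. -/
theorem IsCode.raise (hC : IsCode p C (columnExcess p q)) (h : IsUpperPath p q)
    (hq : m ≤ q.toList.length) :
    IsCode (insertPeak p m) (raiseCode C (columnExcess p q) m)
      (columnExcess (insertPeak p m) (raise q m hq)) := by
  have hm : m ≤ p.toList.length := h.length_eq ▸ hq
  refine ⟨fun e => ?_, fun e j h1 h2 => ?_, fun e x h1 h2 => ?_, fun j hj => ?_⟩
  · rcases edge_insertPeak_cases hm e with rfl | ⟨e, rfl⟩
    · rw [peakEdge_up, peakEdge_down, raiseCode_self, raiseCode_succ]
    · rw [liftEdge_up, liftEdge_down, raiseCode_shift, raiseCode_shift, hC.pair]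
  · rcases edge_insertPeak_cases hm e with rfl | ⟨e, rfl⟩
    · rw [peakEdge_up] at *
      rw [peakEdge_down] at h2
      rcases (show j = m ∨ j = m + 1 by omega) with rfl | rfl
      · exact le_rfl
      · rw [raiseCode_self, raiseCode_succ]
    · rw [liftEdge_up] at *
      rw [liftEdge_down] at h2
      rw [raiseCode_shift]
      have hmid : m ≤ j → j ≤ m + 1 → C e.up ≤ columnExcess p q m := fun h3 h4 =>
        hC.le e m (by unfold shift at h1; split at h1 <;> omega)
          (by unfold shift at h2; split at h2 <;> omega)
      rcases shift_cases m j with rfl | rfl | ⟨i, rfl⟩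
      · rw [raiseCode_self]; exact hmid le_rfl (by omega)
      · rw [raiseCode_succ]; exact hmid (by omega) le_rfl
      · rw [raiseCode_shift]
        exact hC.nest e i (not_lt.1 fun h => absurd (shift_lt_shift.2 h) (not_lt.2 h1))
          (not_lt.1 fun h => absurd (shift_lt_shift.2 h) (not_lt.2 h2))
  · rcases edge_insertPeak_cases hm e with rfl | ⟨e, rfl⟩
    · rw [peakEdge_up] at *
      rw [peakEdge_down] at h2
      rw [raiseCode_self]
      rcases (show x = m ∨ x = m + 1 ∨ x = m + 2 by omega) with rfl | rfl | rfl
      · rw [columnExcess_raise_of_le hm hq le_rfl]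
      · rw [columnExcess_raise_succ hm hq]
      · rw [columnExcess_raise_add_two h hq le_rfl]; omega
    · rw [liftEdge_up] at *
      rw [liftEdge_down] at h2
      rw [raiseCode_shift]
      rcases Nat.lt_or_ge m x with h3 | h3
      · rcases Nat.lt_or_ge (m + 1) x with h4 | h4
        · obtain ⟨i, rfl⟩ : ∃ i, x = i + 2 := ⟨x - 2, by omega⟩
          rw [columnExcess_raise_add_two h hq (by omega)]
          exact (hC.le e i (by unfold shift at h1; split at h1 <;> omega)
            (by unfold shift at h2; split at h2 <;> omega)).trans (Nat.le_add_right _ _)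
        · obtain rfl : x = m + 1 := by omega
          rw [columnExcess_raise_succ hm hq]
          exact hC.le e m (by unfold shift at h1; split at h1 <;> omega)
            (by unfold shift at h2; split at h2 <;> omega)
      · rw [columnExcess_raise_of_le hm hq h3]
        exact hC.le e x (by unfold shift at h1; split at h1 <;> omega)
          (by unfold shift at h2; split at h2 <;> omega)
  · have hj' : p.toList.length + 2 ≤ j := by
      rw [← length_insertUD p.toList m]; exact hj
    obtain ⟨i, rfl⟩ : ∃ i, j = i + 2 := ⟨j - 2, by omega⟩
    rw [raiseCode_add_two (by omega)]
    exact hC.eq_zero i (by omega)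

theorem nextLevel_insertPeak (hm : m ≤ p.toList.length) (j k : ℕ) :
    nextLevel (insertPeak p m) (shift m j) k = nextLevel p j k := by
  unfold nextLevel
  change (if (insertUD p.toList m)[shift m j]? = some U then _ else _) = _
  rw [getElem?_insertUD_shift _ hm]

theorem remaining_raise_of_le (h : IsUpperPath p q) (hq : m ≤ q.toList.length) {x : ℕ}
    (hx : x ≤ m) (k : ℕ) :
    remaining (insertPeak p m) (raiseCode C (columnExcess p q) m)
        (columnExcess (insertPeak p m) (raise q m hq)) x k =
      remaining p C (columnExcess p q) x k := by
  have hm : m ≤ p.toList.length := h.length_eq ▸ hq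
  induction x generalizing k with
  | zero => rfl
  | succ x ih =>
    have h1 := nextLevel_insertPeak hm x k
    rw [shift_of_lt (by omega)] at h1
    rw [remaining, remaining, raiseCode_of_lt (by omega), h1, ih (by omega), ih (by omega),
      columnExcess_raise_of_le hm hq (by omega)]

/-- Each trajectory reaching a moved column gains one unit of `art`: either it ends in a new single
box, or it continues as in the old tiling with two more crossed steps or one more single box. -/
theorem remaining_raise_add_two (hC : IsCode p C (columnExcess p q)) (h : IsUpperPath p q)
    (hq : m ≤ q.toList.length) {x : ℕ} (hx : m ≤ x) (hl : x ≤ p.toList.length) (k : ℕ) :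
    remaining (insertPeak p m) (raiseCode C (columnExcess p q) m)
        (columnExcess (insertPeak p m) (raise q m hq)) (x + 2) k =
      2 + if k < columnExcess p q x then remaining p C (columnExcess p q) x k else 0 := by
  have hm : m ≤ p.toList.length := h.length_eq ▸ hq
  induction x, hx using Nat.le_induction generalizing k with
  | base =>
    rcases Nat.lt_or_ge k (columnExcess p q m) with h1 | h1
    · rw [remaining_succ_of_lt (by rwa [raiseCode_succ]),
        remaining_succ_of_lt (by rwa [raiseCode_self]), remaining_raise_of_le h hq le_rfl,
        if_pos h1]
      ring
    -- On a level not below `M m` the trajectory stands in a new box next to the peak. To its left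
    -- the column `m + 1` has only `M m` boxes, so it ends here.
    · rw [remaining_succ_of_ge (by rwa [raiseCode_succ]), if_neg (not_lt.2 h1), if_neg]
      rw [nextLevel_of_down (getElem?_insertUD_succ p.toList hm), columnExcess_raise_succ hm hq]
      omega
  | succ x hx ih =>
    have h1 := nextLevel_insertPeak hm x k
    rw [shift_of_le hx] at h1
    have hCx := hC.le_right x
    rcases Nat.lt_or_ge k (C x) with h2 | h2
    · rw [remaining_succ_of_lt (x := x + 2) (by rwa [raiseCode_add_two hx]), ih (by omega),
        if_pos (h2.trans_le (hC.le_left x)), if_pos (h2.trans_le hCx), remaining_succ_of_lt h2]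
      ring
    · rw [remaining_succ_of_ge (x := x + 2) (by rwa [raiseCode_add_two hx]), h1, ih (by omega),
        columnExcess_raise_eq_nextLevel h hq hx (by omega), remaining_succ_of_ge h2]
      have : nextLevel p x k < nextLevel p x (columnExcess p q (x + 1)) ↔
          k < columnExcess p q (x + 1) := by
        unfold nextLevel; split <;> omega
      simp only [this]

theorem twiceHistory_raise_peak (h : IsUpperPath p q) (hq : m ≤ q.toList.length) :
    twiceHistory (insertPeak p m) (raiseCode C (columnExcess p q) m)
      (columnExcess (insertPeak p m) (raise q m hq)) m = 0 := by
  rw [twiceHistory, if_neg]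
  rw [raiseCode_self, columnExcess_raise_of_le (h.length_eq ▸ hq) hq le_rfl]
  exact lt_irrefl _

/-- To the left of the peak nothing changes. To its right `remaining_raise_add_two` adds two, also
at up steps that had no trajectory before: strip-growth creates a box of level `C e.up` there. -/
theorem twiceHistory_raise_lift (hC : IsCode p C (columnExcess p q)) (h : IsUpperPath p q)
    (hq : m ≤ q.toList.length) (e : Edge p) :
    twiceHistory (insertPeak p m) (raiseCode C (columnExcess p q) m)
      (columnExcess (insertPeak p m) (raise q m hq)) (shift m e.up) =
    twiceHistory p C (columnExcess p q) e.up + if e.up < m then 0 else 2 := by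
  have hm : m ≤ p.toList.length := h.length_eq ▸ hq
  rw [twiceHistory, raiseCode_shift]
  split
  case isTrue hlt =>
    rcases Nat.lt_or_ge e.up m with h1 | h1
    · rw [shift_of_lt h1, columnExcess_raise_of_le hm hq h1.le] at hlt
      rw [shift_of_lt h1, remaining_raise_of_le h hq h1.le, twiceHistory, if_pos hlt, if_pos h1]
      rfl
    · rw [shift_of_le h1, remaining_raise_add_two hC h hq h1 e.up_lt_length.le, twiceHistory,
        if_neg (not_lt.2 h1), add_comm]
  case isFalse hlt =>
    rcases Nat.lt_or_ge e.up m with h1 | h1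
    · rw [shift_of_lt h1, columnExcess_raise_of_le hm hq h1.le] at hlt
      rw [twiceHistory, if_neg hlt, if_pos h1]
    · rw [shift_of_le h1, columnExcess_raise_eq_nextLevel h hq h1 e.up_lt_length,
        nextLevel_of_up e.getElem?_up] at hlt
      have := hC.le_right e.up
      omega

end insertPeak

/-! ### Removing a peak from an encoded tiling -/

section removePeak

variable {p : DyckWord} {m : ℕ}

theorem height_append_add (l l' : List DyckStep) (i : ℕ) :
    height (l ++ l') (l.length + i) = height l l.length + height l' i := by
  simp only [height, List.take_length_add_append, List.take_length, List.count_append]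
  push_cast; ring

/-- An encoded tiling over `insertPeak p m` that has no trajectory at the peak, but trajectories at
all up steps to the right of it, results from an encoded tiling over `p`. -/
theorem exists_raise_eq {q₀ : DyckWord} {C₀ : ℕ → ℕ} (hm : m ≤ p.toList.length)
    (h : IsUpperPath (insertPeak p m) q₀)
    (hC : IsCode (insertPeak p m) C₀ (columnExcess (insertPeak p m) q₀))
    (hpeak : C₀ m = columnExcess (insertPeak p m) q₀ m)
    (hright : ∀ e : Edge p, m ≤ e.up →
      C₀ (e.up + 2) < columnExcess (insertPeak p m) q₀ (e.up + 2)) :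
    ∃ (q : DyckWord) (hq : m ≤ q.toList.length) (C : ℕ → ℕ), IsUpperPath p q ∧
      IsCode p C (columnExcess p q) ∧ q₀ = raise q m hq ∧
      C₀ = raiseCode C (columnExcess p q) m := by
  have hlen₀ : q₀.toList.length = p.toList.length + 2 := by
    rw [h.length_eq]; exact length_insertUD _ _
  have hP_le : ∀ x ≤ m, height (insertPeak p m).toList x = height p.toList x := fun x hx =>
    height_insertUD_of_le _ hm hx
  have hP_succ : height (insertPeak p m).toList (m + 1) = height p.toList m + 1 :=
    height_insertUD_succ _ hm
  have hP_add : ∀ x, m ≤ x → height (insertPeak p m).toList (x + 2) = height p.toList x :=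
    fun x hx => height_insertUD_add_two _ hm hx
  have hH := h.height_eq
  set M₀ := columnExcess (insertPeak p m) q₀ with hM₀
  -- The absence of a trajectory at the peak makes all `M₀ m` levels crossed, so the next column has
  -- at least as many boxes. Hence `q₀` must also go up at `m`.
  have hpm1 : M₀ m ≤ M₀ (m + 1) := by rw [← hpeak]; exact hC.le_right m
  have hU : height q₀.toList (m + 1) = height q₀.toList m + 1 := by
    have h1 := hH m
    have h2 := hH (m + 1)
    rw [hP_succ] at h2
    rw [hP_le m le_rfl] at h1
    rcases getElem?_cases_of_lt (show m < q₀.toList.length by omega) with a | a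
    · exact height_succ_of_U a
    · have := height_succ_of_D a; omega
  -- Undo `raiseList`: delete the up step at `m` and the last step. To the right of `m` this shifts
  -- the path by `(-1, -1)`.
  set l := q₀.toList.take m ++ (q₀.toList.drop (m + 1)).take (p.toList.length - m) with hl
  have hllen : l.length = p.toList.length := by
    simp only [hl, List.length_append, List.length_take, List.length_drop]; omega
  have htake : (q₀.toList.take m).length = m := by
    simp only [List.length_take]; omega
  have hl_le : ∀ x ≤ m, height l x = height q₀.toList x := by
    intro x hx
    have : l.take x = q₀.toList.take x := by
      rw [hl, List.take_append_of_le_length (by omega), List.take_take, min_eq_left hx]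
    simp [height, this]
  have hl_ge : ∀ x, m ≤ x → x ≤ p.toList.length →
      height l x = height q₀.toList (x + 1) - 1 := by
    intro x h1 h2
    obtain ⟨i, rfl⟩ := Nat.exists_eq_add_of_le h1
    have h3 := height_append_add (q₀.toList.take m)
      ((q₀.toList.drop (m + 1)).take (p.toList.length - m)) i
    rw [htake, ← hl, height_take_drop _ _ (by omega), hU] at h3
    have h4 : height (q₀.toList.take m) m = height q₀.toList m := by
      simp [height, List.take_take]
    rw [h3, h4, show m + 1 + i = m + i + 1 by omega]
    ring
  -- Lowering could push the path below `p` only at the end of an up step of `p`, and the trajectory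
  -- required there provides a box to spare.
  have hge : ∀ x ≤ p.toList.length, height p.toList x ≤ height l x := by
    intro x hx
    rcases Nat.lt_or_ge m x with h1 | h1
    · rw [hl_ge x h1.le hx]
      have h2 := hH (x + 1)
      obtain ⟨j, rfl⟩ : ∃ j, x = j + 1 := ⟨x - 1, by omega⟩
      rw [hP_add j (by omega)] at h2
      rcases Edge.exists_of_lt (show j < p.toList.length by omega) with ⟨e, rfl⟩ | ⟨e, rfl⟩
      · have h3 := hright e (by omega)
        have h4 := e.height_up_succ
        change C₀ (e.up + 2) < M₀ (e.up + 1 + 1) at h3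
        omega
      · have h3 := e.height_down_succ
        have h4 := e.height_down
        omega
    · rw [hl_le x h1, ← hP_le x h1]
      exact h.le x
  have hlast : height l l.length = 0 := by
    rw [hllen, hl_ge _ hm le_rfl]
    have h1 : height q₀.toList (p.toList.length + 1 + 1) = 0 :=
      height_of_length_le q₀ (by omega)
    have h2 := height_nonneg q₀ (p.toList.length + 1)
    rcases getElem?_cases_of_lt (show p.toList.length + 1 < q₀.toList.length by omega) with a | a
    · rw [height_succ_of_U a] at h1; omega
    · rw [height_succ_of_D a] at h1; omega
  set q := dyckWordOfHeight l (fun i hi => (height_nonneg p i).trans (hge i (hllen ▸ hi))) hlast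
    with hqdef
  have hql : q.toList = l := rfl
  have hq : m ≤ q.toList.length := by rw [hql, hllen]; exact hm
  have hup : IsUpperPath p q := ⟨hllen, fun x => by
    rcases le_total x p.toList.length with hx | hx
    · exact hge x hx
    · rw [height_of_length_le p hx]; exact height_nonneg q x⟩
  have hM := hup.height_eq
  rw [hql] at hM
  have hraise : q₀ = raise q m hq := by
    apply DyckWord.ext
    rw [raise_toList]
    refine eq_of_height_eq ?_ fun i hi => ?_
    · rw [length_raiseList hq, hql, hlen₀, hllen]
    · rcases Nat.lt_or_ge m i with h1 | h1
      · obtain ⟨j, rfl⟩ : ∃ j, i = j + 1 := ⟨i - 1, by omega⟩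
        rcases Nat.lt_or_ge p.toList.length j with h2 | h2
        · rw [height_of_length_le q₀ (by omega)]
          exact (height_of_length_le (raise q m hq)
            (by rw [raise_toList, length_raiseList hq, hql, hllen]; omega)).symm
        · rw [height_raiseList_succ (by omega) (by rw [hql, hllen]; exact h2), hql,
            hl_ge j (by omega) h2]
          ring
      · rw [height_raiseList_of_le hq h1, hql, hl_le i h1]
  have hMm : columnExcess p q m = M₀ m := by
    have h1 := hM m
    have h2 := hH m
    rw [hl_le m le_rfl] at h1
    rw [hP_le m le_rfl] at h2
    omega
  refine ⟨q, hq, fun j => C₀ (shift m j), hup, ⟨?_, ?_, ?_, ?_⟩, hraise, ?_⟩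
  · intro e
    have := hC.pair (liftEdge hm e)
    rwa [liftEdge_up, liftEdge_down] at this
  · intro e j h1 h2
    have := hC.nest (liftEdge hm e) (shift m j)
    rw [liftEdge_up, liftEdge_down] at this
    exact this (not_lt.1 fun h => absurd (shift_lt_shift.1 h) (not_lt.2 h1))
      (not_lt.1 fun h => absurd (shift_lt_shift.1 h) (not_lt.2 h2))
  · intro e x h1 h2
    have hle := hC.le (liftEdge hm e)
    rw [liftEdge_up, liftEdge_down] at hle
    have hxl : x ≤ p.toList.length := by have := e.down_lt_length; omega
    have h3 := hM x
    rcases Nat.lt_or_ge e.up m with hem | hem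
    on_goal 1 => rcases Nat.lt_or_ge m x with h4 | h4
    · rw [hl_ge x h4.le hxl] at h3
      have h5 := hH (x + 1)
      obtain ⟨j, rfl⟩ : ∃ j, x = j + 1 := ⟨x - 1, by omega⟩
      have hle' := hle (j + 1 + 1) (by rw [shift_of_lt hem]; omega)
        (by unfold shift; split <;> omega)
      rw [hP_add j (by omega)] at h5
      -- The column after an up step of `g` loses one box. The bound survives because `nest`
      -- compares the code of `e` with that of `g`, which `hright` keeps strictly below the old
      -- column height.
      rcases Edge.exists_of_lt (show j < p.toList.length by omega) with ⟨g, rfl⟩ | ⟨g, rfl⟩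
      · have h6 := hright g (by omega)
        have h7 := g.height_up_succ
        have h8 := hC.nest (liftEdge hm e) (shift m g.up)
        rw [liftEdge_up, liftEdge_down, shift_of_le (show m ≤ g.up by omega)] at h8
        have h9 := h8 (by rw [shift_of_lt hem]; omega) (by unfold shift; split <;> omega)
        change C₀ (g.up + 2) < M₀ (g.up + 1 + 1) at h6
        omega
      · have h6 := g.height_down_succ
        have h7 := g.height_down
        omega
    · have h5 := hle x (by rw [shift_of_lt hem]; exact h1) (by unfold shift; split <;> omega)
      have h6 := hH x
      rw [hl_le x h4] at h3
      rw [hP_le x h4] at h6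
      omega
    · rw [hl_ge x (by omega) hxl] at h3
      have h5 := hH (x + 1)
      -- In the column of `e.up` itself no preceding step inside `e` is available. The box count is
      -- read off the step of `q₀` with index `e.up + 1`, which rises by at most one.
      rcases h1.eq_or_lt with rfl | h1
      · have h6 := hright e hem
        have h7 := hH (e.up + 1 + 1)
        rw [hP_add e.up hem] at h7
        rw [shift_of_le hem]
        change C₀ (e.up + 2) < M₀ (e.up + 1 + 1) at h6
        rcases getElem?_cases_of_lt (show e.up + 1 < q₀.toList.length by omega) with a | a
        · have := height_succ_of_U a; omega
        · have := height_succ_of_D a; omega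
      · obtain ⟨j, rfl⟩ : ∃ j, x = j + 1 := ⟨x - 1, by omega⟩
        have hle' := hle (j + 1 + 1) (by rw [shift_of_le hem]; omega)
          (by rw [shift_of_le (by omega)]; omega)
        rw [hP_add j (by omega)] at h5
        rcases Edge.exists_of_lt (show j < p.toList.length by omega) with ⟨g, rfl⟩ | ⟨g, rfl⟩
        · have h6 := hright g (by omega)
          have h7 := g.height_up_succ
          have h8 := hC.nest (liftEdge hm e) (shift m g.up)
          rw [liftEdge_up, liftEdge_down, shift_of_le (show m ≤ g.up by omega)] at h8
          have h9 := h8 (by rw [shift_of_le hem]; omega) (by rw [shift_of_le (by omega)]; omega)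
          change C₀ (g.up + 2) < M₀ (g.up + 1 + 1) at h6
          omega
        · have h6 := g.height_down_succ
          have h7 := g.height_down
          omega
  · intro j hj
    refine hC.eq_zero _ ?_
    change (insertUD p.toList m).length ≤ _
    rw [length_insertUD, shift_of_le (by omega)]
    omega
  · funext j
    rcases shift_cases m j with rfl | rfl | ⟨i, rfl⟩
    · rw [raiseCode_self, hpeak, hMm]
    · have := hC.pair (peakEdge hm)
      rw [peakEdge_up, peakEdge_down] at this
      rw [raiseCode_succ, ← this, hpeak, hMm]
    · rw [raiseCode_shift]

end removePeak

/-! ### Spread and strip-growth of an encoded tiling -/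

/-- Tiles of one code on one level coincide once they overlap, so a set of such tiles that covers
every box already contains all of them. -/
theorem isCodedBy_of_covers {p : DyckWord} {C M : ℕ → ℕ} {D : Finset Tile}
    (h1 : ∀ t ∈ D, ∃ k, IsTileOf p C M t k)
    (h2 : ∀ c k, k < M c → ∃ t ∈ D, IsTileOf p C M t k ∧ t.x ≤ c ∧ c ≤ t.x + t.width) :
    IsCodedBy D p C M := fun t => ⟨h1 t, fun ⟨k, hk⟩ => by
  obtain ⟨s, hs, hks, h3, h4⟩ := h2 t.x k hk.lt
  rwa [hk.eq_of_overlap hks le_rfl (by omega) h3 h4]⟩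

namespace Tile

variable {t : Tile} {m : ℕ}

theorem spread_of_right_lt (h : t.x + t.width < m) : t.spread m = t := if_pos h

theorem spread_of_lt_left (h : m < t.x) : t.spread m = ⟨t.x + 2, t.y, t.shape⟩ := by
  rw [spread, if_neg (by omega), if_pos h]

theorem spread_of_cut (h1 : t.x ≤ m) (h2 : m ≤ t.x + t.width) :
    t.spread m = ⟨t.x, t.y, insertPeak t.shape (m - t.x)⟩ := by
  rw [spread, if_neg (by omega), if_neg (by omega)]

theorem width_insertPeak (x : ℕ) (y : ℤ) (s : DyckWord) (i : ℕ) :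
    (⟨x, y, insertPeak s i⟩ : Tile).width = s.toList.length + 2 :=
  length_insertUD _ _

end Tile

section stage

variable {p q : DyckWord} {m : ℕ} {C : ℕ → ℕ} {t : Tile} {k : ℕ}

theorem IsTileOf.right_lt_length (ht : IsTileOf p C (columnExcess p q) t k)
    (hC : IsCode p C (columnExcess p q)) (h : IsUpperPath p q) :
    t.x + t.width < p.toList.length := by
  by_contra hc
  have := ht.lt_of_mem hC (c := t.x + t.width) (by omega) le_rfl
  rw [h.isColumnHeight.eq_zero _ (by omega)] at this
  omega

/-- Levels are unaffected by the spread. A cut tile has level below `M m`, so it crosses both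
inserted steps and remains a maximal run. -/
theorem IsTileOf.spread (ht : IsTileOf p C (columnExcess p q) t k)
    (hC : IsCode p C (columnExcess p q)) (h : IsUpperPath p q) (hq : m ≤ q.toList.length) :
    IsTileOf (insertPeak p m) (raiseCode C (columnExcess p q) m)
      (columnExcess (insertPeak p m) (raise q m hq)) (t.spread m) k := by
  have hm : m ≤ p.toList.length := h.length_eq ▸ hq
  have hlen := ht.right_lt_length hC h
  have hlen' : (insertPeak p m).toList.length = p.toList.length + 2 := length_insertUD _ _
  have hP_le : ∀ x ≤ m, height (insertPeak p m).toList x = height p.toList x := fun x hx =>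
    height_insertUD_of_le _ hm hx
  have hP_succ : height (insertPeak p m).toList (m + 1) = height p.toList m + 1 :=
    height_insertUD_succ _ hm
  have hP_add : ∀ x, m ≤ x → height (insertPeak p m).toList (x + 2) = height p.toList x :=
    fun x hx => height_insertUD_add_two _ hm hx
  have hshape : ∀ i ≤ t.width,
      height t.shape.toList i = height p.toList (t.x + i) - height p.toList t.x := fun i hi => by
    rw [ht.shape_eq, height_take_drop _ _ hi]
  rcases Nat.lt_or_ge (t.x + t.width) m with h1 | h1
  · rw [Tile.spread_of_right_lt h1]
    refine ⟨?_, ?_, ?_, ?_, ?_, ?_⟩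
    · rw [ht.y_eq, hP_le _ (by omega)]
    · rw [columnExcess_raise_of_le hm hq (by omega)]; exact ht.lt
    · intro j hj
      rw [raiseCode_of_lt (by omega)]; exact ht.left j hj
    · intro j h2 h3
      rw [raiseCode_of_lt (by omega)]; exact ht.run j h2 h3
    · rw [raiseCode_of_lt h1]; exact ht.right
    · refine eq_of_height_eq ?_ fun i hi => ?_
      · rw [List.length_take, List.length_drop, hlen']
        change t.width = _
        omega
      · have hi : i ≤ t.width := hi
        rw [hshape i hi, height_take_drop _ _ hi, hP_le _ (by omega), hP_le _ (by omega)]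
  rcases Nat.lt_or_ge m t.x with h2 | h2
  · rw [Tile.spread_of_lt_left h2]
    refine ⟨?_, ?_, ?_, ?_, ?_, ?_⟩
    · simp only
      rw [ht.y_eq, hP_add _ h2.le]
    · simp only
      rw [columnExcess_raise_add_two h hq h2.le]
      exact ht.lt.trans_le (Nat.le_add_right _ _)
    · intro j hj
      simp only at hj
      obtain ⟨i, rfl⟩ : ∃ i, j = i + 2 := ⟨j - 2, by omega⟩
      rw [raiseCode_add_two (by omega)]; exact ht.left i (by omega)
    · intro j h3 h4
      change t.x + 2 ≤ j at h3
      change j < t.x + 2 + t.width at h4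
      obtain ⟨i, rfl⟩ : ∃ i, j = i + 2 := ⟨j - 2, by omega⟩
      rw [raiseCode_add_two (by omega)]; exact ht.run i (by omega) (by omega)
    · change raiseCode C _ m (t.x + 2 + t.width) ≤ k
      rw [show t.x + 2 + t.width = t.x + t.width + 2 by omega, raiseCode_add_two (by omega)]
      exact ht.right
    · change t.shape.toList = ((insertPeak p m).toList.drop (t.x + 2)).take t.width
      refine eq_of_height_eq ?_ fun i hi => ?_
      · rw [List.length_take, List.length_drop, hlen']
        change t.width = _
        omega
      · have hi : i ≤ t.width := hi
        rw [hshape i hi, height_take_drop _ _ hi, hP_add _ h2.le,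
          show t.x + 2 + i = t.x + i + 2 by omega, hP_add _ (by omega)]
  · rw [Tile.spread_of_cut h2 h1]
    have hkm := ht.lt_of_mem hC h2 h1
    refine ⟨?_, ?_, ?_, ?_, ?_, ?_⟩
    · simp only
      rw [ht.y_eq, hP_le _ h2]
    · simp only
      rw [columnExcess_raise_of_le hm hq h2]; exact ht.lt
    · intro j hj
      simp only at hj
      rw [raiseCode_of_lt (by omega)]; exact ht.left j hj
    · intro j h3 h4
      rw [Tile.width_insertPeak] at h4
      change t.x ≤ j at h3
      change j < t.x + (t.width + 2) at h4
      rcases shift_cases m j with rfl | rfl | ⟨i, rfl⟩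
      · rwa [raiseCode_self]
      · rwa [raiseCode_succ]
      · rw [raiseCode_shift]
        exact ht.run i (by unfold shift at h3; split at h3 <;> omega)
          (by unfold shift at h4; split at h4 <;> omega)
    · rw [Tile.width_insertPeak]
      change raiseCode C _ m (t.x + t.width + 2) ≤ k
      rw [raiseCode_add_two h1]
      exact ht.right
    · rw [Tile.width_insertPeak]
      change insertUD t.shape.toList (m - t.x) =
        ((insertPeak p m).toList.drop t.x).take (t.width + 2)
      have hmw : m - t.x ≤ t.shape.toList.length := by
        change m - t.x ≤ t.width
        omega
      refine eq_of_height_eq ?_ fun i hi => ?_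
      · rw [length_insertUD, List.length_take, List.length_drop, hlen']
        change t.width + 2 = _
        omega
      · rw [length_insertUD] at hi
        have hi : i ≤ t.width + 2 := hi
        rw [height_take_drop _ _ hi, hP_le _ h2]
        rcases Nat.lt_or_ge (m - t.x) i with h3 | h3
        · rcases Nat.lt_or_ge (m - t.x + 1) i with h4 | h4
          · obtain ⟨j, rfl⟩ : ∃ j, i = j + 2 := ⟨i - 2, by omega⟩
            rw [height_insertUD_add_two _ hmw (by omega), hshape j (by omega), ← add_assoc,
              hP_add _ (by omega)]
          · obtain rfl : i = m - t.x + 1 := by omega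
            rw [height_insertUD_succ _ hmw, hshape _ (by omega), Nat.add_sub_cancel' h2,
              show t.x + (m - t.x + 1) = m + 1 by omega, hP_succ]
            ring
        · rw [height_insertUD_of_le _ hmw h3, hshape _ (by omega), hP_le _ (by omega)]

/-- The new box lies on top of its column, on level `columnExcess p q x`. The codes of both
neighbouring steps are at most this level, so the run has width zero. -/
theorem isTileOf_single (hC : IsCode p C (columnExcess p q)) (h : IsUpperPath p q)
    (hq : m ≤ q.toList.length) {x : ℕ} (hx : m ≤ x) (hU : q.toList[x]? = some U) :
    IsTileOf (insertPeak p m) (raiseCode C (columnExcess p q) m)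
      (columnExcess (insertPeak p m) (raise q m hq)) ⟨x + 2, height q.toList x + 1, 0⟩
      (columnExcess p q x) := by
  have hm : m ≤ p.toList.length := h.length_eq ▸ hq
  have hw : (⟨x + 2, height q.toList x + 1, 0⟩ : Tile).width = 0 := rfl
  refine ⟨?_, ?_, ?_, ?_, ?_, ?_⟩
  · change _ = height (insertUD p.toList m) (x + 2) + 1 + _
    rw [height_insertUD_add_two _ hm hx]
    simp only [h.height_eq x]; ring
  · simp only
    rw [columnExcess_raise_add_two h hq hx, if_pos hU]
    omega
  · intro j hj
    simp only at hj
    rcases hx.eq_or_lt with rfl | hx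
    · obtain rfl : j = m + 1 := by omega
      rw [raiseCode_succ]
    · obtain ⟨i, rfl⟩ : ∃ i, j = i + 2 := ⟨j - 2, by omega⟩
      rw [raiseCode_add_two (by omega), show x = i + 1 by omega]
      exact hC.le_right i
  · intro j h1 h2
    rw [hw] at h2
    omega
  · rw [hw]
    change raiseCode C _ m (x + 2) ≤ _
    rw [raiseCode_add_two hx]
    exact hC.le_left x
  · rw [hw, List.take_zero]; rfl

theorem exists_mem_stage {D : Finset Tile} {x : ℕ} (hx : m ≤ x) (hU : q.toList[x]? = some U)
    (hq : m ≤ q.toList.length) :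
    (⟨x + 2, height q.toList x + 1, 0⟩ : Tile) ∈
      (stripGrowth m (spread m ⟨p.toList, q.toList, D⟩)).tiles := by
  refine Finset.mem_union_right _ (Finset.mem_image.2 ⟨x + 2, Finset.mem_filter.2 ⟨?_, ?_, ?_⟩, ?_⟩)
  · have := lt_length_of_getElem? hU
    change x + 2 ∈ Finset.range (insertUD q.toList m).length
    rw [length_insertUD, Finset.mem_range]
    omega
  · omega
  · exact (getElem?_insertUD_add_two q.toList hq hx).trans hU
  · change (⟨x + 2, height (insertUD q.toList m) (x + 2) + 1, 0⟩ : Tile) = _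
    rw [height_insertUD_add_two _ hq hx]

/-- Old boxes, and those of the inserted columns, are covered by spread tiles through the old
column; the only other boxes are the tops added above up steps of `q`. -/
theorem isCodedBy_stage {D : Finset Tile} (hD : IsCodedBy D p C (columnExcess p q))
    (hC : IsCode p C (columnExcess p q)) (h : IsUpperPath p q) (hq : m ≤ q.toList.length) :
    IsCodedBy (stripGrowth m (spread m ⟨p.toList, q.toList, D⟩)).tiles (insertPeak p m)
      (raiseCode C (columnExcess p q) m) (columnExcess (insertPeak p m) (raise q m hq)) := by
  have hm : m ≤ p.toList.length := h.length_eq ▸ hq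
  have hmem : ∀ t ∈ D,
      t.spread m ∈ (stripGrowth m (spread m ⟨p.toList, q.toList, D⟩)).tiles := fun t ht =>
    Finset.mem_union_left _ (Finset.mem_image_of_mem _ ht)
  refine isCodedBy_of_covers (fun t ht => ?_) (fun c k hk => ?_)
  · rcases Finset.mem_union.1 ht with ht | ht
    · obtain ⟨s, hs, rfl⟩ := Finset.mem_image.1 ht
      obtain ⟨k, hk⟩ := (hD s).1 hs
      exact ⟨k, hk.spread hC h hq⟩
    · obtain ⟨i, hi, rfl⟩ := Finset.mem_image.1 ht
      obtain ⟨-, h1, h2⟩ := Finset.mem_filter.1 hi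
      change (insertUD q.toList m)[i]? = some U at h2
      change ∃ k, IsTileOf _ _ _ ⟨i, height (insertUD q.toList m) i + 1, 0⟩ k
      rcases shift_cases m i with rfl | rfl | ⟨x, rfl⟩
      · omega
      · rw [getElem?_insertUD_succ _ hq] at h2; cases h2
      · have hx : m ≤ x := by unfold shift at h1; split at h1 <;> omega
        rw [getElem?_insertUD_shift _ hq] at h2
        rw [height_insertUD_shift _ hq, shift_of_le hx]
        exact ⟨_, isTileOf_single hC h hq hx h2⟩
  · have hspread : ∀ x, k < columnExcess p q x → ∃ t ∈ D, IsTileOf p C (columnExcess p q) t k ∧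
        t.x ≤ x ∧ x ≤ t.x + t.width := fun x hx => hD.exists_mem hC hx
    have hcut : k < columnExcess p q m → m ≤ c → c ≤ m + 2 →
        ∃ t ∈ (stripGrowth m (spread m ⟨p.toList, q.toList, D⟩)).tiles,
          IsTileOf (insertPeak p m) (raiseCode C (columnExcess p q) m)
            (columnExcess (insertPeak p m) (raise q m hq)) t k ∧
          t.x ≤ c ∧ c ≤ t.x + t.width := by
      intro hk h1 h2
      obtain ⟨t, ht, hkt, h3, h4⟩ := hspread m hk
      refine ⟨_, hmem t ht, hkt.spread hC h hq, ?_⟩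
      rw [Tile.spread_of_cut h3 h4, Tile.width_insertPeak]
      change t.x ≤ c ∧ c ≤ t.x + (t.width + 2)
      omega
    rcases Nat.lt_or_ge m c with h1 | h1
    · rcases Nat.lt_or_ge (m + 1) c with h2 | h2
      · obtain ⟨x, rfl⟩ : ∃ x, c = x + 2 := ⟨c - 2, by omega⟩
        have hx : m ≤ x := by omega
        rcases Nat.lt_or_ge k (columnExcess p q x) with h3 | h3
        · obtain ⟨t, ht, hkt, h4, h5⟩ := hspread x h3
          refine ⟨_, hmem t ht, hkt.spread hC h hq, ?_⟩
          rcases Nat.lt_or_ge m t.x with h6 | h6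
          · rw [Tile.spread_of_lt_left h6]
            change t.x + 2 ≤ x + 2 ∧ x + 2 ≤ t.x + 2 + t.width
            omega
          · rw [Tile.spread_of_cut h6 (by omega), Tile.width_insertPeak]
            change t.x ≤ x + 2 ∧ x + 2 ≤ t.x + (t.width + 2)
            omega
        · rw [columnExcess_raise_add_two h hq hx] at hk
          split at hk
          case isTrue hU =>
            obtain rfl : k = columnExcess p q x := by omega
            exact ⟨_, exists_mem_stage hx hU hq, isTileOf_single hC h hq hx hU, le_rfl,
              Nat.le_add_right _ _⟩
          case isFalse hU => omega
      · obtain rfl : c = m + 1 := by omega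
        rw [columnExcess_raise_succ hm hq] at hk
        exact hcut hk (by omega) (by omega)
    · rw [columnExcess_raise_of_le hm hq h1] at hk
      obtain ⟨t, ht, hkt, h3, h4⟩ := hspread c hk
      refine ⟨_, hmem t ht, hkt.spread hC h hq, ?_⟩
      rcases Nat.lt_or_ge (t.x + t.width) m with h5 | h5
      · rw [Tile.spread_of_right_lt h5]; exact ⟨h3, h4⟩
      · rw [Tile.spread_of_cut (by omega) h5, Tile.width_insertPeak]
        change t.x ≤ c ∧ c ≤ t.x + (t.width + 2)
        omega

theorem upper_stage {l l' : List DyckStep} {T : Finset Tile} (hm : m ≤ l'.length) :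
    (stripGrowth m (spread m ⟨l, l', T⟩)).upper = raiseList l' m := by
  change (insertUD l' m).eraseIdx (m + 1) ++ [D] = raiseList l' m
  have h : (l'.take m).length = m := by simpa using hm
  rw [insertUD, List.append_assoc, List.eraseIdx_append_of_length_le (by omega), h,
    Nat.add_sub_cancel_left]
  simp [raiseList]

end stage

/-! ### Removing the edge with the largest label -/

theorem Edge.card_down_lt (p : DyckWord) {x : ℕ} (hx : x ≤ p.toList.length) :
    (x : ℤ) - height p.toList x =
      2 * ((Finset.univ.filter fun e : Edge p => e.down < x).card : ℤ) := by
  induction x with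
  | zero => simp [height_zero]
  | succ x ih =>
    have ih := ih (by omega)
    rcases getElem?_cases_of_lt (show x < p.toList.length by omega) with h | h
    · have h1 : (Finset.univ.filter fun e : Edge p => e.down < x + 1) =
          (Finset.univ.filter fun e : Edge p => e.down < x) := by
        ext e'
        simp only [Finset.mem_filter, Finset.mem_univ, true_and]
        have : e'.down ≠ x := fun h' => by
          have := e'.getElem?_down; rw [h', h] at this; cases this
        omega
      rw [h1, height_succ_of_U h]
      push_cast; omega
    · obtain ⟨e, he⟩ := Edge.exists_down_eq h
      have h1 : (Finset.univ.filter fun e : Edge p => e.down < x + 1) =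
          insert e (Finset.univ.filter fun e : Edge p => e.down < x) := by
        ext e'
        simp only [Finset.mem_filter, Finset.mem_univ, true_and, Finset.mem_insert]
        constructor
        · intro h'
          rcases Nat.lt_or_ge e'.down x with h2 | h2
          · exact .inr h2
          · exact .inl (Edge.down_injective (by omega))
        · rintro (rfl | h') <;> omega
      rw [h1, Finset.card_insert_of_notMem (by simp [he]), height_succ_of_D h]
      push_cast; omega

/-- Each edge strictly to the left of `e` contributes two steps to the part of the path before the
up step of `e`, each edge above `e` contributes one. -/
theorem Edge.two_mul_card_left_add_card_above {p : DyckWord} (e : Edge p) :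
    2 * (Finset.univ.filter fun e' : Edge p => StrictlyRight e' e).card +
      (Finset.univ.filter fun e' : Edge p => IsAbove e' e).card = e.up := by
  have h1 := Edge.card_up_lt p e.up_lt_length.le
  have h2 := Edge.card_down_lt p e.up_lt_length.le
  have h3 : (Finset.univ.filter fun e' : Edge p => e'.up < e.up) =
      (Finset.univ.filter fun e' : Edge p => StrictlyRight e' e) ∪
        Finset.univ.filter fun e' : Edge p => IsAbove e' e := by
    ext e'
    simp only [Finset.mem_filter, Finset.mem_univ, true_and, Finset.mem_union]
    refine ⟨Edge.strictlyRight_or_isAbove, ?_⟩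
    rintro (h | h)
    · exact e'.up_lt_down.trans h
    · exact h.1
  rw [h3, Finset.card_union_of_disjoint] at h1
  · change _ = 2 * ((Finset.univ.filter fun e' : Edge p => StrictlyRight e' e).card : ℤ) at h2
    push_cast at h1
    omega
  · refine Finset.disjoint_filter.2 fun e' _ h4 h5 => ?_
    have h6 : e'.down < e.up := h4
    have h7 := h5.2
    have := e.up_lt_down
    omega

theorem eq_insertUD {w : List DyckStep} {m : ℕ} (h1 : w[m]? = some U) (h2 : w[m + 1]? = some D) :
    w = insertUD (w.take m ++ w.drop (m + 2)) m := by
  have hl := lt_length_of_getElem? h2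
  have ht : (w.take m).length = m := by simp; omega
  have h3 : w.drop m = U :: D :: w.drop (m + 2) := by
    rw [List.drop_eq_getElem_cons (by omega), List.drop_eq_getElem_cons hl]
    rw [List.getElem?_eq_getElem (by omega)] at h1
    rw [List.getElem?_eq_getElem hl] at h2
    rw [Option.some.inj h1, Option.some.inj h2]
  have h4 : (w.take m ++ w.drop (m + 2)).take m = w.take m := by
    rw [List.take_append_of_le_length ht.ge, List.take_take, min_self]
  have h5 : (w.take m ++ w.drop (m + 2)).drop m = w.drop (m + 2) := by
    rw [List.drop_append_of_le_length ht.ge]; simp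
  rw [insertUD, h4, h5]
  conv_lhs => rw [← List.take_append_drop m w, h3]
  simp

theorem exists_insertPeak_eq {p : DyckWord} {m : ℕ} (h1 : p.toList[m]? = some U)
    (h2 : p.toList[m + 1]? = some D) :
    ∃ p' : DyckWord, m ≤ p'.toList.length ∧ p = insertPeak p' m := by
  have heq := eq_insertUD h1 h2
  have hl := lt_length_of_getElem? h2
  set l := p.toList.take m ++ p.toList.drop (m + 2) with hl'
  have hml : m ≤ l.length := by simp [hl']; omega
  have hlen : p.toList.length = l.length + 2 := by
    conv_lhs => rw [heq]
    exact length_insertUD _ _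
  have hh : ∀ i, height l i = height p.toList (shift m i) := fun i => by
    conv_rhs => rw [heq]
    exact (height_insertUD_shift _ hml _).symm
  refine ⟨dyckWordOfHeight l (fun i _ => by rw [hh]; exact height_nonneg p _) ?_, hml,
    DyckWord.ext heq⟩
  rw [hh, shift_of_le hml, ← hlen, height_of_length_le p le_rfl]

theorem semilength_insertPeak (p : DyckWord) (m : ℕ) :
    (insertPeak p m).semilength = p.semilength + 1 :=
  count_insertUD _ _ _

/-! ### Edges of a tree with an inserted leaf -/

section liftEdge

variable {p : DyckWord} {m : ℕ}

theorem shift_injective (m : ℕ) : Function.Injective (shift m) := fun i j h => by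
  have h1 := shift_lt_shift (m := m) (i := i) (j := j)
  have h2 := shift_lt_shift (m := m) (i := j) (j := i)
  omega

theorem liftEdge_injective (hm : m ≤ p.toList.length) :
    Function.Injective (liftEdge hm) := fun e e' h => by
  have h1 := congrArg Edge.up h
  rw [liftEdge_up, liftEdge_up] at h1
  exact Edge.up_injective (shift_injective m h1)

theorem liftEdge_ne_peakEdge (hm : m ≤ p.toList.length) (e : Edge p) :
    liftEdge hm e ≠ peakEdge hm := fun h => by
  have h1 := congrArg Edge.up h
  rw [liftEdge_up, peakEdge_up] at h1
  unfold shift at h1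
  split at h1 <;> omega

theorem isAbove_liftEdge (hm : m ≤ p.toList.length) (e e' : Edge p) :
    IsAbove (liftEdge hm e) (liftEdge hm e') ↔ IsAbove e e' := by
  simp only [IsAbove, liftEdge_up, liftEdge_down, shift_lt_shift]

theorem strictlyRight_liftEdge (hm : m ≤ p.toList.length) (e e' : Edge p) :
    StrictlyRight (liftEdge hm e) (liftEdge hm e') ↔ StrictlyRight e e' := by
  simp only [StrictlyRight, liftEdge_up, liftEdge_down, shift_lt_shift]

theorem not_isAbove_peakEdge (hm : m ≤ p.toList.length) (e : Edge p) :
    ¬ IsAbove (peakEdge hm) (liftEdge hm e) := by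
  rintro ⟨h1, h2⟩
  rw [peakEdge_up, liftEdge_up] at h1
  rw [peakEdge_down, liftEdge_down] at h2
  have := e.up_lt_down
  unfold shift at h1 h2
  split at h1 <;> split at h2 <;> omega

theorem card_filter_insertPeak (hm : m ≤ p.toList.length) (P : Edge (insertPeak p m) → Prop)
    [DecidablePred P] :
    (Finset.univ.filter P).card = (Finset.univ.filter fun e : Edge p => P (liftEdge hm e)).card +
      if P (peakEdge hm) then 1 else 0 := by
  classical
  have h : (Finset.univ : Finset (Edge (insertPeak p m))) =
      insert (peakEdge hm) (Finset.univ.map ⟨liftEdge hm, liftEdge_injective hm⟩) := by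
    ext e
    rcases edge_insertPeak_cases hm e with rfl | ⟨e, rfl⟩ <;> simp
  have hn : peakEdge hm ∉ Finset.univ.map ⟨liftEdge hm, liftEdge_injective hm⟩ := by
    simp [liftEdge_ne_peakEdge]
  rw [h, Finset.filter_insert]
  split
  · rw [Finset.card_insert_of_notMem fun hc => hn (Finset.mem_filter.1 hc).1, Finset.filter_map,
      Finset.card_map]
    rfl
  · rw [Finset.filter_map, Finset.card_map]
    rfl

end liftEdge

variable {p : DyckWord}

/-- The edge with the largest label is a leaf. -/
theorem NaturalLabel.down_eq_of_isMax (T₁ : NaturalLabel p) {e : Edge p}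
    (he : ∀ e', T₁.label e' ≤ T₁.label e) : e.down = e.up + 1 := by
  have h1 := e.up_lt_down
  have h2 := e.down_lt_length
  by_contra hne
  rcases getElem?_cases_of_lt (show e.up + 1 < p.toList.length by omega) with h | h
  · obtain ⟨g, hg⟩ := Edge.exists_up_eq h
    rcases Edge.strictlyRight_or_isAbove (show e.up < g.up by omega) with h3 | h3
    · have : e.down < g.up := h3
      omega
    · exact absurd (T₁.increasing _ _ h3) (not_lt.2 (he g))
  · have h3 := e.height_ge (k := e.up + 1 + 1) (by omega) (by omega)
    rw [height_succ_of_D h, e.height_up_succ] at h3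
    omega

theorem NaturalLabel.exists_insertPeak_eq (T₁ : NaturalLabel p) (hp : p.semilength ≠ 0) :
    ∃ (p' : DyckWord) (m : ℕ), m ≤ p'.toList.length ∧ p = insertPeak p' m ∧
      ∃ e : Edge p, e.up = m ∧ ∀ e', T₁.label e' ≤ T₁.label e := by
  set e := T₁.label.symm ⟨p.semilength - 1, by omega⟩ with he
  have hmax : ∀ e', T₁.label e' ≤ T₁.label e := fun e' => by
    rw [he, Equiv.apply_symm_apply, Fin.le_def]
    have := (T₁.label e').2
    simp only
    omega
  obtain ⟨p', h1, h2⟩ := DyckTiling.exists_insertPeak_eq e.getElem?_up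
    (by rw [← T₁.down_eq_of_isMax hmax]; exact e.getElem?_down)
  exact ⟨p', e.up, h1, h2, e, rfl, hmax⟩

/-! ### Natural labels without their largest label -/

section restrict

variable {m : ℕ}

theorem label_liftEdge_lt (hm : m ≤ p.toList.length) (T₁ : NaturalLabel (insertPeak p m))
    (hmax : ∀ e, T₁.label e ≤ T₁.label (peakEdge hm)) (e : Edge p) :
    T₁.label (liftEdge hm e) < T₁.label (peakEdge hm) :=
  (hmax _).lt_of_ne fun h => liftEdge_ne_peakEdge hm e (T₁.label.injective h)

theorem label_peakEdge (hm : m ≤ p.toList.length) (T₁ : NaturalLabel (insertPeak p m))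
    (hmax : ∀ e, T₁.label e ≤ T₁.label (peakEdge hm)) :
    (T₁.label (peakEdge hm) : ℕ) = p.semilength := by
  have h1 := hmax (T₁.label.symm ⟨p.semilength, by rw [semilength_insertPeak]; omega⟩)
  rw [Equiv.apply_symm_apply, Fin.le_def] at h1
  have h2 := (T₁.label (peakEdge hm)).2
  have h3 := semilength_insertPeak p m
  simp only at h1
  omega

/-- The natural label of `Tree(p)` induced by a natural label of the tree of `insertPeak p m` in
which the inserted peak has the largest label. -/
noncomputable def NaturalLabel.restrict (hm : m ≤ p.toList.length)
    (T₁ : NaturalLabel (insertPeak p m))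
    (hmax : ∀ e, T₁.label e ≤ T₁.label (peakEdge hm)) :
    NaturalLabel p where
  label := Equiv.ofBijective
    (fun e => ⟨T₁.label (liftEdge hm e), by
      rw [← label_peakEdge hm T₁ hmax]; exact label_liftEdge_lt hm T₁ hmax e⟩) (by
      rw [Fintype.bijective_iff_injective_and_card]
      refine ⟨fun e e' h => ?_, by rw [Edge.card, Fintype.card_fin]⟩
      exact liftEdge_injective hm (T₁.label.injective (Fin.ext (Fin.mk.inj h))))
  increasing e' e h := T₁.increasing _ _ ((isAbove_liftEdge hm e' e).2 h)

theorem restrict_label (hm : m ≤ p.toList.length) (T₁ : NaturalLabel (insertPeak p m))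
    (hmax : ∀ e, T₁.label e ≤ T₁.label (peakEdge hm)) (e : Edge p) :
    ((T₁.restrict hm hmax).label e : ℕ) = T₁.label (liftEdge hm e) := rfl

/-- The removed edge has the largest label, so it is an inversion exactly for the edges to its
right. -/
theorem inversions_liftEdge (hm : m ≤ p.toList.length) (T₁ : NaturalLabel (insertPeak p m))
    (hmax : ∀ e, T₁.label e ≤ T₁.label (peakEdge hm)) (e : Edge p) :
    inversions T₁ (liftEdge hm e) =
      inversions (T₁.restrict hm hmax) e + if e.up < m then 0 else 1 := by
  rw [inversions, card_filter_insertPeak hm]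
  congr 1
  · simp only [liftEdge_up, shift_lt_shift]
    rfl
  · simp only [peakEdge_up, liftEdge_up, label_liftEdge_lt hm T₁ hmax e, and_true]
    unfold shift
    split <;> split <;> omega

theorem inversions_peakEdge (hm : m ≤ p.toList.length) (T₁ : NaturalLabel (insertPeak p m))
    (hmax : ∀ e, T₁.label e ≤ T₁.label (peakEdge hm)) :
    inversions T₁ (peakEdge hm) = 0 := by
  rw [inversions, Finset.card_eq_zero, Finset.filter_eq_empty_iff]
  exact fun e _ h => absurd h.2 (not_lt.2 (hmax e))

theorem insertionHistory_of_lt (hm : m ≤ p.toList.length) (T₁ : NaturalLabel (insertPeak p m))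
    (hmax : ∀ e, T₁.label e ≤ T₁.label (peakEdge hm))
    {i : Fin (insertPeak p m).semilength} (hi : i < p.semilength) :
    insertionHistory T₁ i = insertionHistory (T₁.restrict hm hmax) ⟨i, hi⟩ := by
  set e := (T₁.restrict hm hmax).label.symm ⟨i, hi⟩ with he
  have hle : T₁.label (liftEdge hm e) = i := by
    ext
    rw [← restrict_label hm T₁ hmax, he, Equiv.apply_symm_apply]
  have hsymm : T₁.label.symm i = liftEdge hm e := by rw [← hle, Equiv.symm_apply_apply]
  have hpeak : ¬ T₁.label (peakEdge hm) < i := by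
    rw [Fin.lt_def, label_peakEdge hm T₁ hmax]; omega
  rw [insertionHistory, insertionHistory, hsymm, ← he, card_filter_insertPeak hm,
    card_filter_insertPeak hm, if_neg fun h => hpeak h.2, if_neg (not_isAbove_peakEdge hm e)]
  simp only [strictlyRight_liftEdge, isAbove_liftEdge]
  rfl

/-- For the largest label the restriction to smaller labels is vacuous, and counting the steps
before the up step of the peak gives its index. -/
theorem insertionHistory_last (hm : m ≤ p.toList.length) (T₁ : NaturalLabel (insertPeak p m))
    (hmax : ∀ e, T₁.label e ≤ T₁.label (peakEdge hm))
    {i : Fin (insertPeak p m).semilength} (hi : i = p.semilength) :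
    insertionHistory T₁ i = m := by
  have hi : T₁.label (peakEdge hm) = i := Fin.ext (by rw [label_peakEdge hm T₁ hmax, hi])
  have h := Edge.two_mul_card_left_add_card_above (peakEdge hm)
  rw [peakEdge_up] at h
  rw [insertionHistory, ← hi, Equiv.symm_apply_apply]
  conv_rhs => rw [← h]
  congr 3
  refine Finset.filter_congr fun e _ => and_iff_left_of_imp fun h1 => ?_
  refine (hmax e).lt_of_ne fun h2 => ?_
  rw [T₁.label.injective h2] at h1
  have h3 : (peakEdge hm).down < (peakEdge hm).up := h1
  exact absurd (peakEdge hm).up_lt_down h3.asymm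

theorem DTS_insertPeak (hm : m ≤ p.toList.length) (T₁ : NaturalLabel (insertPeak p m))
    (hmax : ∀ e, T₁.label e ≤ T₁.label (peakEdge hm)) :
    DTS T₁ = stripGrowth m (spread m (DTS (T₁.restrict hm hmax))) := by
  have h : List.ofFn (insertionHistory T₁) =
      List.ofFn (insertionHistory (T₁.restrict hm hmax)) ++ [m] := by
    apply List.ext_getElem
    · simp [semilength_insertPeak]
    · intro i h1 h2
      rw [List.length_ofFn, semilength_insertPeak] at h1
      rw [List.getElem_ofFn]
      rcases Nat.lt_or_ge i p.semilength with h3 | h3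
      · rw [List.getElem_append_left (by simpa using h3), List.getElem_ofFn]
        exact insertionHistory_of_lt hm T₁ hmax h3
      · obtain rfl : i = p.semilength := by omega
        rw [insertionHistory_last hm T₁ hmax rfl, List.getElem_append_right (by simp)]
        simp
  rw [DTS, h, List.foldl_append]
  rfl

end restrict

/-! ### The tiling `DTS(T₁)` -/

/-- The upper path `q` and the code `C` of an encoded tiling over `p` whose Hermite history is the
sequence of numbers of inversions of `T₁`. -/
structure IsInversionCode (T₁ : NaturalLabel p) (q : DyckWord) (C : ℕ → ℕ) : Prop where
  upper : IsUpperPath p q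
  code : IsCode p C (columnExcess p q)
  history : ∀ e : Edge p, 2 * inversions T₁ e = twiceHistory p C (columnExcess p q) e.up

theorem IsInversionCode.raise {m : ℕ} (hm : m ≤ p.toList.length)
    {T₁ : NaturalLabel (insertPeak p m)} (hmax : ∀ e, T₁.label e ≤ T₁.label (peakEdge hm))
    {q : DyckWord} {C : ℕ → ℕ} (h : IsInversionCode (T₁.restrict hm hmax) q C)
    (hq : m ≤ q.toList.length) :
    IsInversionCode T₁ (raise q m hq) (raiseCode C (columnExcess p q) m) where
  upper := h.upper.raise hq
  code := h.code.raise h.upper hq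
  history e := by
    rcases edge_insertPeak_cases hm e with rfl | ⟨e, rfl⟩
    · rw [inversions_peakEdge hm T₁ hmax, peakEdge_up, twiceHistory_raise_peak h.upper hq]
    · rw [inversions_liftEdge hm T₁ hmax, liftEdge_up,
        twiceHistory_raise_lift h.code h.upper hq, ← h.history e]
      split <;> ring

/-- An existing trajectory has positive total `art`, so zero inversions at the peak mean no
trajectory there, while the positive inversion numbers to its right force trajectories. These are
the hypotheses of `exists_raise_eq`. -/
theorem IsInversionCode.exists_of_insertPeak {m : ℕ} (hm : m ≤ p.toList.length)
    {T₁ : NaturalLabel (insertPeak p m)} (hmax : ∀ e, T₁.label e ≤ T₁.label (peakEdge hm))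
    {q₀ : DyckWord} {C₀ : ℕ → ℕ} (h : IsInversionCode T₁ q₀ C₀) :
    ∃ (q : DyckWord) (hq : m ≤ q.toList.length) (C : ℕ → ℕ),
      IsInversionCode (T₁.restrict hm hmax) q C ∧ q₀ = DyckTiling.raise q m hq ∧
        C₀ = raiseCode C (columnExcess p q) m := by
  have hpeak : C₀ m = columnExcess (insertPeak p m) q₀ m := by
    have h1 := h.history (peakEdge hm)
    rw [inversions_peakEdge hm T₁ hmax, peakEdge_up, twiceHistory] at h1
    split at h1
    · have := two_le_remaining (insertPeak p m) C₀ (columnExcess (insertPeak p m) q₀) m (C₀ m)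
      omega
    · have := h.code.le_left m
      omega
  have hright : ∀ e : Edge p, m ≤ e.up →
      C₀ (e.up + 2) < columnExcess (insertPeak p m) q₀ (e.up + 2) := by
    intro e he
    have h1 := h.history (liftEdge hm e)
    rw [inversions_liftEdge hm T₁ hmax, if_neg (by omega), liftEdge_up, shift_of_le he,
      twiceHistory] at h1
    by_contra hc
    rw [if_neg hc] at h1
    omega
  obtain ⟨q, hq, C, h1, h2, rfl, rfl⟩ := exists_raise_eq hm h.upper h.code hpeak hright
  refine ⟨q, hq, C, ⟨h1, h2, fun e => ?_⟩, rfl, rfl⟩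
  have h3 := h.history (liftEdge hm e)
  rw [inversions_liftEdge hm T₁ hmax, liftEdge_up, twiceHistory_raise_lift h2 h1 hq] at h3
  split at h3 <;> omega

/-- Uniqueness is part of the induction: a competing code over the larger path is a raised code over
the smaller one, where it is already unique. -/
theorem DTS_spec (T₁ : NaturalLabel p) :
    ∃ (q : DyckWord) (C : ℕ → ℕ), IsInversionCode T₁ q C ∧
      (∀ q' C', IsInversionCode T₁ q' C' → q' = q ∧ C' = C) ∧
      (DTS T₁).lower = p.toList ∧ (DTS T₁).upper = q.toList ∧
      IsCodedBy (DTS T₁).tiles p C (columnExcess p q) := by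
  induction hn : p.semilength generalizing p with
  | zero =>
    have hl : p.toList.length = 0 := by
      have := p.two_mul_semilength_eq_length
      omega
    have hnil := List.length_eq_zero_iff.1 hl
    have hno : ∀ e : Edge p, False := fun e => by have := e.up_lt_length; omega
    have hzero : ∀ x, columnExcess p p x = 0 := fun x => by simp [columnExcess]
    have hDTS : DTS T₁ = ⟨[], [], ∅⟩ := by
      have : List.ofFn (insertionHistory T₁) = [] := by
        rw [← List.length_eq_zero_iff, List.length_ofFn, hn]
      rw [DTS, this, List.foldl_nil]
    refine ⟨p, fun _ => 0, ⟨⟨rfl, fun _ => le_rfl⟩, ⟨fun e => (hno e).elim, fun e => (hno e).elim,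
      fun e => (hno e).elim, fun _ _ => rfl⟩, fun e => (hno e).elim⟩, fun q' C' h => ⟨?_, ?_⟩,
      ?_, ?_, ?_⟩
    · apply DyckWord.ext
      rw [hnil, ← List.length_eq_zero_iff, h.upper.length_eq, hl]
    · funext j
      exact h.code.eq_zero j (by omega)
    · rw [hDTS, hnil]
    · rw [hDTS, hnil]
    · intro t
      rw [hDTS]
      simp only [Finset.notMem_empty, false_iff, not_exists]
      intro k hk
      have := hk.lt
      rw [hzero] at this
      omega
  | succ n ih =>
    obtain ⟨p', m, hm, rfl, e, he, hmax⟩ := T₁.exists_insertPeak_eq (by omega)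
    obtain rfl : e = peakEdge hm := Edge.up_injective (by rw [he, peakEdge_up])
    rw [semilength_insertPeak] at hn
    obtain ⟨q, C, h1, h2, h3, h4, h5⟩ := ih (T₁.restrict hm hmax) (by omega)
    have hq : m ≤ q.toList.length := by rw [h1.upper.length_eq]; exact hm
    have hD : DTS (T₁.restrict hm hmax) =
        ⟨p'.toList, q.toList, (DTS (T₁.restrict hm hmax)).tiles⟩ :=
      Diagram.ext h3 h4 rfl
    refine ⟨raise q m hq, raiseCode C (columnExcess p' q) m, h1.raise hm hmax hq, ?_, ?_, ?_, ?_⟩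
    · intro q₀ C₀ h
      obtain ⟨q', hq', C', h6, rfl, rfl⟩ := h.exists_of_insertPeak hm hmax
      obtain ⟨rfl, rfl⟩ := h2 q' C' h6
      exact ⟨rfl, rfl⟩
    · rw [DTS_insertPeak hm T₁ hmax, hD]; rfl
    · rw [DTS_insertPeak hm T₁ hmax, hD, upper_stage hq]; rfl
    · rw [DTS_insertPeak hm T₁ hmax, hD]
      exact isCodedBy_stage h5 h1.code h1.upper hq

theorem isConstructedFrom_inversions_iff (T₁ : NaturalLabel p) (D : Diagram) :
    IsConstructedFrom p (inversions T₁) D ↔ D = DTS T₁ := by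
  obtain ⟨q, C, h1, h2, h3, h4, h5⟩ := DTS_spec T₁
  constructor
  · rintro ⟨hD, hH⟩
    obtain ⟨hl, q', hu, hq', C', hC', hD'⟩ := isCoverInclusiveDyckTiling_iff.1 hD
    rw [isHermiteHistory_iff hD' hC' hq'.isColumnHeight] at hH
    obtain ⟨rfl, rfl⟩ := h2 q' C' ⟨hq', hC', hH⟩
    refine Diagram.ext (hl.trans h3.symm) (hu.trans h4.symm) ?_
    ext t
    rw [hD' t, h5 t]
  · rintro rfl
    exact ⟨isCoverInclusiveDyckTiling_iff.2 ⟨h3, q, h4, h1.upper, C, h1.code, h5⟩,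
      (isHermiteHistory_iff h5 h1.code h1.upper.isColumnHeight).2 h1.history⟩

end DyckTiling

theorem mainTheorem1 (p : DyckWord) (T₁ : DyckTiling.NaturalLabel p) :
    (∃! DR : Finset DyckTiling.Tile,
        DyckTiling.IsRegionTiling p (DyckTiling.weakLabel T₁) DR) ∧
    ∀ DR : Finset DyckTiling.Tile,
      DyckTiling.IsRegionTiling p (DyckTiling.weakLabel T₁) DR →
      (∃! a : DyckTiling.Edge p → Fin p.semilength, DyckTiling.IsAnchorSequence p DR a) ∧
      ∀ a : DyckTiling.Edge p → Fin p.semilength,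
        DyckTiling.IsAnchorSequence p DR a →
        (∃! D₁ : DyckTiling.Diagram,
            DyckTiling.IsConstructedFrom p (DyckTiling.bSequence a) D₁) ∧
        ∀ D₁ : DyckTiling.Diagram,
          DyckTiling.IsConstructedFrom p (DyckTiling.bSequence a) D₁ →
          D₁ = DyckTiling.DTS T₁ := by
  open DyckTiling in
  refine ⟨existsUnique_isRegionTiling T₁, fun DR hDR => ?_⟩
  have ha := isAnchorSequence_iff hDR
  refine ⟨⟨_, (ha _).2 rfl, fun a h => (ha a).1 h⟩, fun a h => ?_⟩
  rw [(ha a).1 h, bSequence_rev]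
  have hD := isConstructedFrom_inversions_iff T₁
  exact ⟨⟨_, (hD _).2 rfl, fun D h => (hD D).1 h⟩, fun D h => (hD D).1 h⟩
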